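/- Let $\mathbb{P}^d$ be complex projective space, let $k\ge 0$, $\ell\ge 1$ be integers with $k+\ell=d$, and let $X\subset\mathbb{P}^d$ be a real subvariety (the zero set in $\mathbb{P}^d=\mathbb{P}^d(\mathbb{C})$ of a set of homogeneous polynomials with real coefficients) of pure dimension $k$, i.e. every irreducible component of $X$ has dimension $k$, so that $X$ has codimension $\ell$. Let $X(\mathbb{R})$ denote the set of points of $X$ having real homogeneous coordinates. For a real linear subspace $V\subset\mathbb{P}^d$ of dimension $\ell-1$, we say that $X$ is hyperbolic with respect to $V$ if $V\cap X=\emptyset$ and $X\cap U\subset X(\mathbb{R})$ for every real linear subspace $U\subset\mathbb{P}^d$ of dimension $\ell$ containing $V$ (all intersections being taken over $\mathbb{C}$). Let $\mathbb{G}(\ell-1,d)(\mathbb{R})$ be the Grassmannian of real linear subspaces of $\mathbb{P}^d$ of dimension $\ell-1$, with its classical topology, let $Y\subset\mathbb{G}(\ell-1,d)$ be the set of all $(\ell-1)$-dimensional linear subspaces of $\mathbb{P}^d$ that intersect $X$, and let $Y(\mathbb{R})=Y\cap\mathbb{G}(\ell-1,d)(\mathbb{R})$ be the set of its real members (those may meet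 $X$ in non-real points only). **Theorem.** Assume that $X$ is hyperbolic with respect to $V\in\mathbb{G}(\ell-1,d)(\mathbb{R})$, and let $C(V)$ be the connected component of $\mathbb{G}(\ell-1,d)(\mathbb{R})\setminus Y(\mathbb{R})$ that contains $V$. Then $X$ is hyperbolic with respect to every $V'\in C(V)$. -/

import Mathlib

open scoped LinearAlgebra.Projectivization

noncomputable section

namespace HypVar

/-! Complex projective space, its algebraic subsets, and the Zariski topology. -/

/-- The complex projective space of dimension `d`, as a set of closed points. -/
abbrev CProj (d : ℕ) : Type := ℙ ℂ (Fin (d + 1) → ℂ)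

/-- A set of polynomials all of which are homogeneous (of possibly different degrees). -/
def AllHomogeneous {d : ℕ} {R : Type} [CommSemiring R]
    (S : Set (MvPolynomial (Fin (d + 1)) R)) : Prop :=
  ∀ f ∈ S, ∃ n : ℕ, f.IsHomogeneous n

/-- The common zero locus in projective space of a set of polynomials, evaluated at homogeneous
coordinates of the point. It is only used for sets of homogeneous polynomials, for which it does
not depend on the choice of the coordinates, see `eval_rep_eq_zero_iff`. -/
def zeroLocus {d : ℕ} (S : Set (MvPolynomial (Fin (d + 1)) ℂ)) : Set (CProj d) :=
  {p | ∀ f ∈ S, MvPolynomial.eval p.rep f = 0}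

theorem eval_rep_eq_zero_iff {d n : ℕ} {f : MvPolynomial (Fin (d + 1)) ℂ}
    (hf : f.IsHomogeneous n) (v : Fin (d + 1) → ℂ) (hv : v ≠ 0) :
    MvPolynomial.eval (Projectivization.mk ℂ v hv).rep f = 0 ↔ MvPolynomial.eval v f = 0 := by
  obtain ⟨a, ha⟩ := Projectivization.exists_smul_eq_mk_rep ℂ v hv
  have h : MvPolynomial.eval ((a : ℂ) • v) f = (a : ℂ) ^ n * MvPolynomial.eval v f := by
    rw [MvPolynomial.eval_eq', MvPolynomial.eval_eq', Finset.mul_sum]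
    refine Finset.sum_congr rfl fun e he => ?_
    have hn : ∑ i, e i = n := by
      have := hf (MvPolynomial.mem_support_iff.1 he)
      rw [← Finsupp.degree_eq_sum, Finsupp.degree_eq_weight_one]
      exact this
    simp only [Pi.smul_apply, smul_eq_mul, mul_pow, Finset.prod_mul_distrib,
      Finset.prod_pow_eq_pow_sum, hn]
    ring
  rw [← ha, Units.smul_def, h]
  simp

/-- Algebraic subsets of projective space: zero loci of sets of homogeneous polynomials. -/
def IsAlgebraic {d : ℕ} (X : Set (CProj d)) : Prop :=
  ∃ S : Set (MvPolynomial (Fin (d + 1)) ℂ), AllHomogeneous S ∧ X = zeroLocus S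

/-- The Zariski topology on projective space: the closed sets are the algebraic subsets. -/
@[reducible] def zariski (d : ℕ) : TopologicalSpace (CProj d) :=
  TopologicalSpace.ofClosed {X | IsAlgebraic X}
    (by
      refine ⟨{1}, ?_, ?_⟩
      · rintro f rfl
        exact ⟨0, MvPolynomial.isHomogeneous_one _ _⟩
      · ext p
        simp [zeroLocus])
    (by
      intro A hA
      refine ⟨{f | ∃ S : Set (MvPolynomial (Fin (d + 1)) ℂ),
        AllHomogeneous S ∧ zeroLocus S ∈ A ∧ f ∈ S}, ?_, ?_⟩
      · rintro f ⟨S, hS, -, hf⟩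
        exact hS f hf
      · ext p
        constructor
        · rintro hp f ⟨S, -, hSA, hf⟩
          exact hp _ hSA f hf
        · intro hp X hX
          obtain ⟨S, hS, rfl⟩ := hA hX
          exact fun f hf => hp f ⟨S, hS, hX, hf⟩)
    (by
      rintro _ ⟨S, hS, rfl⟩ _ ⟨T, hT, rfl⟩
      refine ⟨{h | ∃ f ∈ S, ∃ g ∈ T, h = f * g}, ?_, ?_⟩
      · rintro _ ⟨f, hf, g, hg, rfl⟩
        obtain ⟨m, hm⟩ := hS f hf
        obtain ⟨n, hn⟩ := hT g hg
        exact ⟨m + n, hm.mul hn⟩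
      · ext p
        constructor
        · rintro (hp | hp) _ ⟨f, hf, g, hg, rfl⟩
          · simp [hp f hf]
          · simp [hp g hg]
        · intro hp
          by_contra hcon
          rw [Set.mem_union, not_or] at hcon
          obtain ⟨h1, h2⟩ := hcon
          simp only [zeroLocus, Set.mem_ofPred_eq, not_forall] at h1 h2
          obtain ⟨f, hf, hf0⟩ := h1
          obtain ⟨g, hg, hg0⟩ := h2
          have := hp (f * g) ⟨f, hf, g, hg, rfl⟩
          rw [map_mul, mul_eq_zero] at this
          exact this.elim hf0 hg0)

theorem isClosed_zariski_iff {d : ℕ} (X : Set (CProj d)) :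
    @IsClosed _ (zariski d) X ↔ IsAlgebraic X := by
  rw [← @isOpen_compl_iff _ X (zariski d)]
  change Xᶜᶜ ∈ {X | IsAlgebraic X} ↔ _
  rw [compl_compl]
  rfl

/-- `X` has pure dimension `k`: every irreducible component of `X` has dimension `k`, the
dimension being the Krull dimension in the Zariski topology. -/
def IsPureDim {d : ℕ} (X : Set (CProj d)) (k : ℕ) : Prop :=
  letI : TopologicalSpace (CProj d) := zariski d
  ∀ Z ∈ irreducibleComponents X, topologicalKrullDim Z = (k : WithBot ℕ∞)

/-- A real subvariety of complex projective space: an algebraic subset cut out by homogeneous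
polynomials with real coefficients. -/
def IsRealSubvariety {d : ℕ} (X : Set (CProj d)) : Prop :=
  ∃ S : Set (MvPolynomial (Fin (d + 1)) ℝ),
    AllHomogeneous S ∧ X = zeroLocus (MvPolynomial.map Complex.ofRealHom '' S)

/-! Real points and real linear subspaces. -/

/-- The real coordinate space, with its standard scalar product. -/
abbrev RVec (d : ℕ) : Type := EuclideanSpace ℝ (Fin (d + 1))

/-- The inclusion of the real coordinate space in the complex one. -/
def toC (d : ℕ) : RVec d →ₛₗ[Complex.ofRealHom] (Fin (d + 1) → ℂ) where
  toFun v := fun i => (v i : ℂ)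
  map_add' v w := by
    ext i
    simp
  map_smul' c v := by
    ext i
    simp

theorem toC_injective (d : ℕ) : Function.Injective (toC d) := by
  intro v w h
  ext i
  exact Complex.ofReal_injective (congrFun h i)

/-- The real points of projective space: those that have real homogeneous coordinates. -/
def realLocus (d : ℕ) : Set (CProj d) :=
  Set.range (Projectivization.map (toC d) (toC_injective d))

/-- The set `X(ℝ)` of real points of `X`. -/
def realPoints {d : ℕ} (X : Set (CProj d)) : Set (CProj d) := X ∩ realLocus d

/-- The set of points of projective space that lie on the linear subspace defined by a vector
subspace. -/
def linearPoints {d : ℕ} (W : Submodule ℂ (Fin (d + 1) → ℂ)) : Set (CProj d) :=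
  {p | p.submodule ≤ W}

/-- The complex vector subspace spanned by a real one. -/
def complexify {d : ℕ} (W : Submodule ℝ (RVec d)) : Submodule ℂ (Fin (d + 1) → ℂ) :=
  Submodule.span ℂ (toC d '' W)

theorem linearIndependent_toC {d : ℕ} {ι : Type} [Fintype ι] {b : ι → RVec d}
    (hb : LinearIndependent ℝ b) : LinearIndependent ℂ (fun i => toC d (b i)) := by
  rw [Fintype.linearIndependent_iff] at hb ⊢
  intro c hc i
  have hre : ∑ j, (c j).re • b j = 0 := by
    ext x
    have := congrArg Complex.re (congrFun hc x)
    simpa [toC] using this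
  have him : ∑ j, (c j).im • b j = 0 := by
    ext x
    have := congrArg Complex.im (congrFun hc x)
    simpa [toC] using this
  exact Complex.ext (hb _ hre i) (hb _ him i)

theorem finrank_complexify {d : ℕ} (W : Submodule ℝ (RVec d)) :
    Module.finrank ℂ (complexify W) = Module.finrank ℝ W := by
  let b := Module.finBasis ℝ W
  have hb : LinearIndependent ℝ (fun i => (b i : RVec d)) :=
    b.linearIndependent.map' W.subtype W.ker_subtype
  have hspan : complexify W = Submodule.span ℂ (Set.range fun i => toC d (b i)) := by
    apply le_antisymm
    · refine Submodule.span_le.2 ?_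
      rintro _ ⟨w, hw, rfl⟩
      have h := congrArg Subtype.val (b.sum_repr ⟨w, hw⟩)
      simp only [AddSubmonoidClass.coe_finsetSum, SetLike.val_smul] at h
      rw [← h, map_sum]
      refine Submodule.sum_mem _ fun i _ => ?_
      rw [LinearMap.map_smulₛₗ]
      exact Submodule.smul_mem _ _ (Submodule.subset_span ⟨i, rfl⟩)
    · refine Submodule.span_le.2 ?_
      rintro _ ⟨i, rfl⟩
      exact Submodule.subset_span ⟨_, (b i).2, rfl⟩
  rw [hspan, finrank_span_eq_card (linearIndependent_toC hb), Fintype.card_fin]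

/-! Grassmannians. -/

/-- The complex Grassmannian of `m`-dimensional vector subspaces of `ℂ^(d+1)`, that is, of linear
subspaces of dimension `m - 1` of the projective space of dimension `d`. -/
def CGrass (m d : ℕ) : Type :=
  {W : Submodule ℂ (Fin (d + 1) → ℂ) // Module.finrank ℂ W = m}

/-- The set of real points of the Grassmannian: the `m`-dimensional vector subspaces of
`ℝ^(d+1)`, that is, the real linear subspaces of dimension `m - 1` of the projective space of
dimension `d`. -/
def RGrass (m d : ℕ) : Type :=
  {W : Submodule ℝ (RVec d) // Module.finrank ℝ W = m}

/-- A real linear subspace, viewed as a linear subspace of complex projective space. -/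
def RGrass.toCGrass {m d : ℕ} (V : RGrass m d) : CGrass m d :=
  ⟨complexify V.1, (finrank_complexify V.1).trans V.2⟩

/-- The set of all (complex) points of a linear subspace. -/
def CGrass.points {m d : ℕ} (V : CGrass m d) : Set (CProj d) := linearPoints V.1

/-- The classical topology on the real Grassmannian: the one induced by the operator norm of the
orthogonal projections onto the subspaces. -/
instance (m d : ℕ) : TopologicalSpace (RGrass m d) :=
  TopologicalSpace.induced (fun V : RGrass m d => (V.1.starProjection : RVec d →L[ℝ] RVec d))
    inferInstance

/-- The subset of the complex Grassmannian associated with `X` by the incidence correspondence: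
the linear subspaces that intersect `X`. -/
def associated {d : ℕ} (X : Set (CProj d)) (m : ℕ) : Set (CGrass m d) :=
  {W | (W.points ∩ X).Nonempty}

/-- The real points of the associated subset: the real linear subspaces that intersect `X`
(possibly in non-real points only). -/
def associatedReal {d : ℕ} (X : Set (CProj d)) (m : ℕ) : Set (RGrass m d) :=
  RGrass.toCGrass ⁻¹' associated X m

/-- `X` (of codimension `ℓ`) is hyperbolic with respect to the real linear subspace `V` of
dimension `ℓ - 1`: `V` does not intersect `X`, and every real linear subspace `U` of dimension `ℓ`
containing `V` intersects `X` in real points only. -/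
def IsHyperbolic {d ℓ : ℕ} (X : Set (CProj d)) (V : RGrass ℓ d) : Prop :=
  V.toCGrass.points ∩ X = ∅ ∧
    ∀ U : RGrass (ℓ + 1) d, V.1 ≤ U.1 → X ∩ U.toCGrass.points ⊆ realPoints X

end HypVar

end

/-! Hyperbolicity is shown to be locally constant off the associated set; connectedness then gives
the theorem. By `isHyperbolic_iff`, it means that a coordinate vector of a point of `X` whose
imaginary part lies in the real vector space of `V` is itself real.

Near a given subspace, bases can be chosen in a small ball of tuples all of whose spans miss `X`
(`isOpen_avoids`), and one basis vector at a time can be moved along a segment. So it suffices to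
compare `V₀ + ⟨w⟩` and `V₀ + ⟨w'⟩`, with `V₀` of codimension `k + 2` and every `V₀ + ⟨w_s⟩` on the
segment missing `X`. Projection from `V₀` is finite on `X`, so by a dimension count it maps each
irreducible component onto the zero set of one form `f` on a projective space of dimension `k + 1`
(`exists_form_of_isPureDim`).

The rest is a root-counting homotopy (`not_imVec_pos_of_imHyperbolic`). A point of `X` with
imaginary part in `V₀ + c w'`, `c > 0`, gives a root in the upper half plane of the restriction of
`f` to a line of direction `w'`. After a small shift of the line by `iα w`, `α > 0`, the direction
is turned back from `w'` to `w`. Roots cannot escape to infinity, since `f` does not vanish at the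
directions, nor become real, by hyperbolicity for `w`. The root surviving at direction `w`
contradicts that same hyperbolicity. -/

noncomputable section

namespace HypVar

open MvPolynomial Topology

-- Linear substitutions and the grading.

attribute [local instance] MvPolynomial.gradedAlgebra

/-- The substitution of the linear forms given by the rows of a linear map. -/
def linSubst {σ τ : Type} [Fintype σ] [DecidableEq σ] (π : (σ → ℂ) →ₗ[ℂ] (τ → ℂ)) :
    MvPolynomial τ ℂ →ₐ[ℂ] MvPolynomial σ ℂ :=
  aeval fun i => ∑ j, C (π (Pi.single j 1) i) * X j

section LinSubst

variable {σ τ : Type} [Fintype σ] [DecidableEq σ] (π : (σ → ℂ) →ₗ[ℂ] (τ → ℂ))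

theorem eval_linSubst_X (x : σ → ℂ) (i : τ) : eval x (linSubst π (X i)) = π x i := by
  conv_rhs => rw [← LinearMap.sum_single_apply (fun _ : σ => ℂ) x]
  simp only [linSubst, aeval_X, map_sum, map_mul, eval_C, eval_X, Finset.sum_apply]
  refine Finset.sum_congr rfl fun j _ => ?_
  rw [show (Pi.single j (x j) : σ → ℂ) = x j • Pi.single j 1 by
    rw [← Pi.single_smul, smul_eq_mul, mul_one], map_smul, Pi.smul_apply, smul_eq_mul, mul_comm]

theorem eval_linSubst (x : σ → ℂ) (f : MvPolynomial τ ℂ) :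
    eval x (linSubst π f) = eval (π x) f := by
  have h : (aeval x : MvPolynomial σ ℂ →ₐ[ℂ] ℂ).comp (linSubst π) = aeval (π x) := by
    ext i
    simpa [aeval_eq_eval] using eval_linSubst_X π x i
  simpa [aeval_eq_eval] using DFunLike.congr_fun h f

theorem isHomogeneous_linSubst_X (i : τ) : (linSubst π (X i)).IsHomogeneous 1 := by
  rw [linSubst, aeval_X]
  exact IsHomogeneous.sum _ _ _ fun j _ => isHomogeneous_C_mul_X _ _

theorem isHomogeneous_linSubst {f : MvPolynomial τ ℂ} {n : ℕ} (hf : f.IsHomogeneous n) :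
    (linSubst π f).IsHomogeneous n := by
  have := hf.aeval (fun i => ∑ j, C (π (Pi.single j 1) i) * X j) (n := 1)
    (fun i => IsHomogeneous.sum _ _ _ fun j _ => isHomogeneous_C_mul_X _ _)
  rwa [one_mul] at this

/-- Linear forms have degree one, so substitution respects the grading. Hence homogeneous ideals
contract to homogeneous ideals, which later makes the equation of the image a form. -/
theorem homogeneousComponent_linSubst (f : MvPolynomial τ ℂ) (n : ℕ) :
    homogeneousComponent n (linSubst π f) = linSubst π (homogeneousComponent n f) := by
  conv_lhs => rw [← sum_homogeneousComponent f, map_sum, map_sum]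
  by_cases hn : n ≤ f.totalDegree
  · rw [Finset.sum_eq_single_of_mem n (Finset.mem_range.2 (Nat.lt_succ_of_le hn))]
    · exact homogeneousComponent_eq_self
        (isHomogeneous_linSubst π (homogeneousComponent_isHomogeneous n f))
    · intro m _ hm
      rw [homogeneousComponent_of_mem
        (isHomogeneous_linSubst π (homogeneousComponent_isHomogeneous m f)), if_neg hm.symm]
  · rw [homogeneousComponent_eq_zero n f (not_le.1 hn), map_zero]
    refine Finset.sum_eq_zero fun m hm => ?_
    rw [homogeneousComponent_of_mem
      (isHomogeneous_linSubst π (homogeneousComponent_isHomogeneous m f)), if_neg]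
    have := Finset.mem_range.1 hm
    omega

end LinSubst

theorem homogeneousComponent_mul_succ {σ : Type} {y g : MvPolynomial σ ℂ}
    (hy : y.IsHomogeneous 1) (n : ℕ) :
    homogeneousComponent (n + 1) (g * y) = homogeneousComponent n g * y := by
  have h := DirectSum.coe_decompose_mul_of_right_mem_of_le (homogeneousSubmodule σ ℂ) (a := g)
    (b := y) (i := 1) (n := n + 1) hy (by omega)
  have e (f : MvPolynomial σ ℂ) (m : ℕ) :
      (DirectSum.decompose (homogeneousSubmodule σ ℂ) f m : MvPolynomial σ ℂ) =
        homogeneousComponent m f := decomposition.decompose'_apply f m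
  rwa [e, e] at h

/-! ### Finiteness of a linear projection whose center misses the variety. -/

section Finiteness

variable {σ τ : Type} [Fintype σ] [DecidableEq σ] [Fintype τ]
  (π : (σ → ℂ) →ₗ[ℂ] (τ → ℂ)) (P : Ideal (MvPolynomial σ ℂ))

/-- If the linear forms of `π` and a homogeneous ideal have no common zero except the origin, then
modulo the ideal every form of large degree is a combination of these linear forms. -/
theorem exists_homogeneous_combination (hP : P.IsHomogeneous (homogeneousSubmodule σ ℂ))
    (h0 : ∀ x, (∀ f ∈ P, eval x f = 0) → π x = 0 → x = 0) :
    ∃ N : ℕ, ∀ n ≥ N, ∀ f : MvPolynomial σ ℂ, f.IsHomogeneous (n + 1) →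
      ∃ g : τ → MvPolynomial σ ℂ, (∀ i, (g i).IsHomogeneous n) ∧
        f - ∑ i, g i * linSubst π (X i) ∈ P := by
  set I : Ideal (MvPolynomial σ ℂ) := P ⊔ Ideal.span (Set.range fun i => linSubst π (X i)) with hI
  -- Nullstellensatz: `I` has no zero except possibly the origin, so its radical contains all
  -- variables, and `I` contains a power of the irrelevant ideal.
  have hrad : idealOfVars σ ℂ ≤ I.radical := by
    rw [← vanishingIdeal_zeroLocus_eq_radical (K := ℂ), Ideal.span_le]
    rintro _ ⟨j, rfl⟩ x hx
    have hx0 : x = 0 := by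
      refine h0 x (fun f hf => ?_) (funext fun i => ?_)
      · simpa [aeval_eq_eval] using hx f (Ideal.mem_sup_left hf)
      · rw [← eval_linSubst_X]
        simpa [aeval_eq_eval] using
          hx (linSubst π (X i)) (Ideal.mem_sup_right (Ideal.subset_span ⟨i, rfl⟩))
    simp [hx0]
  obtain ⟨N, hN⟩ := Ideal.exists_pow_le_of_le_radical_of_fg hrad (idealOfVars_fg σ ℂ)
  refine ⟨N, fun n hn f hf => ?_⟩
  have hfI : f ∈ I := by
    refine hN ((mem_pow_idealOfVars_iff N f).2 fun e he => ?_)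
    have := hf.degree_eq_sum_deg_support he
    change n + 1 = e.degree at this
    omega
  obtain ⟨p, hp, q, hq, rfl⟩ := Submodule.mem_sup.1 hfI
  obtain ⟨c, rfl⟩ := (Ideal.mem_span_range_iff_exists_fun).1 hq
  -- Taking the part of degree `n + 1` of the relation truncates each coefficient to degree `n`; the
  -- error stays in `P` because `P` is homogeneous.
  refine ⟨fun i => homogeneousComponent n (c i), fun i => homogeneousComponent_isHomogeneous _ _, ?_⟩
  have := homogeneousComponent_eq_self hf
  rw [map_add, map_sum] at this
  simp_rw [homogeneousComponent_mul_succ (isHomogeneous_linSubst_X π _)] at this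
  rw [← this, add_sub_cancel_right]
  exact homogeneousComponent_mem_of_mem hP hp _

/-- The projection from a linear subspace that does not meet a projective variety is finite. -/
theorem isIntegral_mk_comp_linSubst (hP : P.IsHomogeneous (homogeneousSubmodule σ ℂ))
    (h0 : ∀ x, (∀ f ∈ P, eval x f = 0) → π x = 0 → x = 0) :
    ((Ideal.Quotient.mk P).comp (linSubst π).toRingHom).IsIntegral := by
  obtain ⟨N, hN⟩ := exists_homogeneous_combination π P hP h0
  set φ := (Ideal.Quotient.mk P).comp (linSubst π).toRingHom with hφ
  let _ : Algebra (MvPolynomial τ ℂ) (MvPolynomial σ ℂ ⧸ P) := φ.toAlgebra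
  let _ : Module (MvPolynomial τ ℂ) (MvPolynomial σ ℂ ⧸ P) := Algebra.toModule
  have hfg (n : ℕ) := homogeneousSubmodule_fg (σ := σ) (R := ℂ) n
  choose S hS using hfg
  let T : Finset (MvPolynomial σ ℂ) := by
    -- Generators of the forms of degree at most `N` suffice: above that degree, a form is reduced
    -- modulo `P` to coefficients of degree one less.
    classical exact (Finset.range (N + 1)).biUnion S
  let M : Submodule (MvPolynomial τ ℂ) (MvPolynomial σ ℂ ⧸ P) :=
    Submodule.span _ (Ideal.Quotient.mk P '' (T : Set (MvPolynomial σ ℂ)))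
  have hM : ∀ n, ∀ f : MvPolynomial σ ℂ, f.IsHomogeneous n → Ideal.Quotient.mk P f ∈ M := by
    intro n
    induction n using Nat.strong_induction_on with
    | _ n ih =>
      intro f hf
      by_cases hn : n < N + 1
      · have hfS : f ∈ Submodule.span ℂ (S n : Set (MvPolynomial σ ℂ)) := by
          rw [hS n]; exact hf
        induction hfS using Submodule.span_induction with
        | mem x hx =>
          refine Submodule.subset_span ⟨x, ?_, rfl⟩
          exact Finset.mem_coe.2 (Finset.mem_biUnion.2 ⟨n, Finset.mem_range.2 hn, hx⟩)
        | zero => simp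
        | add x y _ _ hx hy =>
          have hxM : ∀ z ∈ Submodule.span ℂ (S n : Set (MvPolynomial σ ℂ)),
              z.IsHomogeneous n := fun z hz => by rw [hS n] at hz; exact hz
          rw [map_add]
          exact M.add_mem (hx (hxM _ ‹_›)) (hy (hxM _ ‹_›))
        | smul a x hxs hx =>
          have hxM : x.IsHomogeneous n := by rw [hS n] at hxs; exact hxs
          have : Ideal.Quotient.mk P (a • x) =
              (C a : MvPolynomial τ ℂ) • Ideal.Quotient.mk P x := by
            rw [smul_eq_C_mul, map_mul]
            change _ = Ideal.Quotient.mk P (linSubst π (C a)) * Ideal.Quotient.mk P x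
            rw [linSubst, algHom_C, MvPolynomial.algebraMap_eq]
          rw [this]
          exact M.smul_mem _ (hx hxM)
      · obtain ⟨m, rfl⟩ : ∃ m, n = m + 1 := ⟨n - 1, by omega⟩
        obtain ⟨g, hg, hfg⟩ := hN m (by omega) f hf
        rw [Ideal.Quotient.mk_eq_mk_iff_sub_mem _ _ |>.2 hfg, map_sum]
        refine M.sum_mem fun i _ => ?_
        have : Ideal.Quotient.mk P (g i * linSubst π (X i)) =
            (X i : MvPolynomial τ ℂ) • Ideal.Quotient.mk P (g i) := by
          rw [Algebra.smul_def, RingHom.algebraMap_toAlgebra, map_mul, mul_comm]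
          rfl
        rw [this]
        exact M.smul_mem _ (ih m (by omega) _ (hg i))
  have htop : M = ⊤ := by
    refine eq_top_iff.2 fun z _ => ?_
    obtain ⟨f, rfl⟩ := Ideal.Quotient.mk_surjective z
    rw [← sum_homogeneousComponent f, map_sum]
    exact M.sum_mem fun i _ => hM i _ (homogeneousComponent_isHomogeneous i f)
  have : Module.Finite (MvPolynomial τ ℂ) (MvPolynomial σ ℂ ⧸ P) :=
    ⟨⟨(T.finite_toSet.image _).toFinset, by rw [Set.Finite.coe_toFinset]; exact htop⟩⟩
  exact algebraMap_isIntegral_iff.2 inferInstance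

end Finiteness

/-! ### The image of a finite projection as a hypersurface. -/

section Image

variable {σ τ : Type} [Fintype σ] [DecidableEq σ] [Fintype τ]
  {π : (σ → ℂ) →ₗ[ℂ] (τ → ℂ)} {P : Ideal (MvPolynomial σ ℂ)}

/-- Lying over: the points of the closure of the image of a finite projection lift. -/
theorem exists_zero_lift
    (hint : ((Ideal.Quotient.mk P).comp (linSubst π).toRingHom).IsIntegral) (y : τ → ℂ)
    (hy : ∀ f, linSubst π f ∈ P → eval y f = 0) :
    ∃ x, (∀ f ∈ P, eval x f = 0) ∧ π x = y := by
  set φ := (Ideal.Quotient.mk P).comp (linSubst π).toRingHom with hφ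
  let _ : Algebra (MvPolynomial τ ℂ) (MvPolynomial σ ℂ ⧸ P) := φ.toAlgebra
  let _ : Module (MvPolynomial τ ℂ) (MvPolynomial σ ℂ ⧸ P) := Algebra.toModule
  have : Algebra.IsIntegral (MvPolynomial τ ℂ) (MvPolynomial σ ℂ ⧸ P) :=
    algebraMap_isIntegral_iff.1 hint
  have hmax : (vanishingIdeal ℂ {y} : Ideal (MvPolynomial τ ℂ)).IsMaximal :=
    isMaximal_iff_eq_vanishingIdeal_singleton.2 ⟨y, rfl⟩
  obtain ⟨M, hM, hMc⟩ := Ideal.exists_ideal_over_maximal_of_isIntegral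
    (S := MvPolynomial σ ℂ ⧸ P) (vanishingIdeal ℂ {y}) (by
      intro f hf
      rw [mem_vanishingIdeal_singleton_iff, aeval_eq_eval]
      exact hy f (Ideal.Quotient.eq_zero_iff_mem.1 hf))
  have hM' : (M.comap (Ideal.Quotient.mk P)).IsMaximal :=
    Ideal.comap_isMaximal_of_surjective _ Ideal.Quotient.mk_surjective
  obtain ⟨x, hx⟩ := isMaximal_iff_eq_vanishingIdeal_singleton.1 hM'
  refine ⟨x, fun f hf => ?_, funext fun i => ?_⟩
  · have : f ∈ M.comap (Ideal.Quotient.mk P) := by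
      rw [Ideal.mem_comap, Ideal.Quotient.eq_zero_iff_mem.2 hf]
      exact M.zero_mem
    rw [hx, mem_vanishingIdeal_singleton_iff] at this
    simpa [aeval_eq_eval] using this
  · have h1 : (X i - C (y i) : MvPolynomial τ ℂ) ∈ vanishingIdeal ℂ {y} := by
      simp
    rw [← hMc] at h1
    have h2 : linSubst π (X i - C (y i)) ∈ M.comap (Ideal.Quotient.mk P) := h1
    rw [hx, mem_vanishingIdeal_singleton_iff, aeval_eq_eval] at h2
    have h3 := eval_linSubst π x (X i - C (y i))
    rw [map_sub (eval (π x)), eval_X, eval_C] at h3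
    rw [← sub_eq_zero, ← h3]
    exact h2

/-- A prime ideal that is not too small contracts to a principal ideal along a finite projection. -/
theorem exists_contraction_eq_span [P.IsPrime]
    (hint : ((Ideal.Quotient.mk P).comp (linSubst π).toRingHom).IsIntegral)
    (s : LTSeries (PrimeSpectrum (MvPolynomial σ ℂ))) (hs : Fintype.card τ ≤ s.length + 1)
    (hsP : P ≤ s.head.asIdeal) :
    ∃ p : MvPolynomial τ ℂ, ∀ f, linSubst π f ∈ P ↔ p ∣ f := by
  set Q : Ideal (MvPolynomial τ ℂ) := P.comap (linSubst π).toRingHom with hQ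
  have hmem (f : MvPolynomial τ ℂ) : f ∈ Q ↔ linSubst π f ∈ P := Iff.rfl
  have hQp : Q.IsPrime := Ideal.comap_isPrime _ _
  by_cases hQ0 : Q = ⊥
  · refine ⟨0, fun f => ?_⟩
    rw [← hmem, hQ0, Ideal.mem_bot, zero_dvd_iff]
  obtain ⟨p, hpQ, hp⟩ := hQp.exists_mem_prime_of_ne_bot hQ0
  refine ⟨p, fun f => ?_⟩
  rw [← hmem, ← Ideal.mem_span_singleton]
  suffices Q = Ideal.span {p} by rw [this]
  -- Otherwise `0 < (p) < Q` could be placed below the contraction of the chain `s`, giving a chain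
  -- of length `s.length + 2`, longer than the dimension `card τ` allows.
  by_contra hne
  have hlt : Ideal.span {p} < Q :=
    lt_of_le_of_ne ((Ideal.span_singleton_le_iff_mem _).2 hpQ) (Ne.symm hne)
  -- Incomparability: strict inclusions of primes above `P` stay strict under contraction along an
  -- integral map.
  have hmono : StrictMonoOn (PrimeSpectrum.comap (linSubst π).toRingHom)
      {J | P ≤ J.asIdeal} := by
    intro J hJ K hK hJK
    obtain ⟨hle, x, hxK, hxJ⟩ := SetLike.lt_iff_le_and_exists.1
      (show J.asIdeal < K.asIdeal from hJK)
    obtain ⟨q, hqm, hq⟩ := hint (Ideal.Quotient.mk P x)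
    have hsurj := Ideal.Quotient.mk_surjective (I := P)
    refine Ideal.comap_lt_comap_of_root_mem_sdiff (f := (linSubst π).toRingHom)
      (I := J.asIdeal) (J := K.asIdeal) (p := q) hle ⟨hxK, hxJ⟩ ?_ ?_
    · exact Polynomial.map_monic_ne_zero hqm
    · apply hJ
      rw [← Ideal.Quotient.eq_zero_iff_mem, Polynomial.hom_eval₂]
      exact hq
  have hge (i : Fin (s.length + 1)) : P ≤ (s i).asIdeal :=
    hsP.trans (s.monotone (Fin.zero_le i))
  let t : LTSeries (PrimeSpectrum (MvPolynomial τ ℂ)) :=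
    { length := s.length
      toFun := fun i => PrimeSpectrum.comap (linSubst π).toRingHom (s i)
      step := fun i => hmono (hge _) (hge _) (s.step i) }
  have hp' : (Ideal.span {p}).IsPrime := (Ideal.span_singleton_prime hp.ne_zero).2 hp
  have ht : (⟨Ideal.span {p}, hp'⟩ : PrimeSpectrum (MvPolynomial τ ℂ)) < t.head := by
    refine lt_of_lt_of_le (show _ < (⟨Q, hQp⟩ : PrimeSpectrum _) from hlt) ?_
    exact Ideal.comap_mono hsP
  have ht2 : (⟨⊥, Ideal.isPrime_bot⟩ : PrimeSpectrum (MvPolynomial τ ℂ)) < (t.cons _ ht).head := by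
    rw [RelSeries.head_cons]
    refine lt_of_le_of_ne (show (⊥ : Ideal _) ≤ _ from bot_le) fun h => hp.ne_zero ?_
    have h' : (⊥ : Ideal (MvPolynomial τ ℂ)) = Ideal.span {p} :=
      congrArg PrimeSpectrum.asIdeal h
    exact Ideal.span_singleton_eq_bot.1 h'.symm
  have hdim := Order.LTSeries.length_le_krullDim ((t.cons _ ht).cons _ ht2)
  have hd2 : ringKrullDim (MvPolynomial τ ℂ) = Fintype.card τ := by
    rw [MvPolynomial.ringKrullDim_of_isNoetherianRing, ringKrullDim_eq_zero_of_field, zero_add,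
      Nat.card_eq_fintype_card]
  rw [← ringKrullDim, hd2] at hdim
  simp only [RelSeries.cons_length] at hdim
  have : s.length + 1 + 1 ≤ Fintype.card τ := by exact_mod_cast hdim
  omega

/-- The image of a variety of dimension at least `card τ - 2` under a finite projection is the zero
set of one form. -/
theorem exists_form_image_eq [P.IsPrime] (hP : P.IsHomogeneous (homogeneousSubmodule σ ℂ))
    (h0 : ∀ x, (∀ f ∈ P, eval x f = 0) → π x = 0 → x = 0)
    (s : LTSeries (PrimeSpectrum (MvPolynomial σ ℂ))) (hs : Fintype.card τ ≤ s.length + 1)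
    (hsP : P ≤ s.head.asIdeal) :
    ∃ (D : ℕ) (p : MvPolynomial τ ℂ), p.IsHomogeneous D ∧
      ∀ y, eval y p = 0 ↔ ∃ x, (∀ f ∈ P, eval x f = 0) ∧ π x = y := by
  have hint := isIntegral_mk_comp_linSubst π P hP h0
  obtain ⟨p, hp⟩ := exists_contraction_eq_span hint s hs hsP
  have hpP : linSubst π p ∈ P := (hp p).2 dvd_rfl
  refine ⟨p.totalDegree, p, ?_, fun y => ⟨fun hy => ?_, ?_⟩⟩
  · by_cases hp0 : p = 0
    · simpa [hp0] using isHomogeneous_zero τ ℂ 0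
    -- The contraction is homogeneous, so `p` divides each of its own components; by degree only the
    -- top one can be nonzero.
    have hcomp (n : ℕ) (hn : n ≠ p.totalDegree) : homogeneousComponent n p = 0 := by
      by_contra hne
      have hdvd : p ∣ homogeneousComponent n p := by
        rw [← hp, ← homogeneousComponent_linSubst]
        exact homogeneousComponent_mem_of_mem hP hpP n
      have h1 := totalDegree_le_of_dvd_of_isDomain hdvd hne
      rw [(homogeneousComponent_isHomogeneous n p).totalDegree hne] at h1
      exact hne (homogeneousComponent_eq_zero n p (lt_of_le_of_ne h1 (Ne.symm hn)))
    have := sum_homogeneousComponent p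
    rw [Finset.sum_eq_single_of_mem p.totalDegree (by simp) fun n _ hn => hcomp n hn] at this
    have h1 := homogeneousComponent_isHomogeneous p.totalDegree p
    rwa [this] at h1
  · refine exists_zero_lift hint y fun f hf => ?_
    obtain ⟨g, rfl⟩ := (hp f).1 hf
    rw [map_mul, hy, zero_mul]
  · rintro ⟨x, hx, rfl⟩
    rw [← eval_linSubst]
    exact hx _ hpP

end Image

/-! ### Cones and homogeneous ideals of projective sets. -/

theorem eval_smul_of_isHomogeneous {σ : Type} [Fintype σ] {n : ℕ} {f : MvPolynomial σ ℂ}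
    (hf : f.IsHomogeneous n) (a : ℂ) (v : σ → ℂ) : eval (a • v) f = a ^ n * eval v f := by
  rw [eval_eq', eval_eq', Finset.mul_sum]
  refine Finset.sum_congr rfl fun e he => ?_
  have hn : ∑ i, e i = n := by
    rw [hf.degree_eq_sum_deg_support he]
    exact (Finset.sum_subset (Finset.subset_univ _) fun i _ hi => by simpa using hi).symm
  simp only [Pi.smul_apply, smul_eq_mul, mul_pow, Finset.prod_mul_distrib,
    Finset.prod_pow_eq_pow_sum, hn]
  ring

/-- The homogeneous coordinates of the points of a set of points of projective space. -/
def coneOver {d : ℕ} (S : Set (CProj d)) : Set (Fin (d + 1) → ℂ) :=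
  {v | ∃ hv : v ≠ 0, Projectivization.mk ℂ v hv ∈ S}

theorem smul_mem_coneOver {d : ℕ} {S : Set (CProj d)} {v : Fin (d + 1) → ℂ} {a : ℂ} (ha : a ≠ 0)
    (hv : v ∈ coneOver S) : a • v ∈ coneOver S := by
  obtain ⟨hv0, hv⟩ := hv
  refine ⟨smul_ne_zero ha hv0, ?_⟩
  have : Projectivization.mk ℂ (a • v) (smul_ne_zero ha hv0) = Projectivization.mk ℂ v hv0 :=
    (Projectivization.mk_eq_mk_iff' ℂ _ _ _ _).2 ⟨a, rfl⟩
  rwa [this]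

theorem coneOver_mono {d : ℕ} {S T : Set (CProj d)} (h : S ⊆ T) : coneOver S ⊆ coneOver T :=
  fun _ ⟨hv, hvS⟩ => ⟨hv, h hvS⟩

theorem rep_mem_coneOver {d : ℕ} {S : Set (CProj d)} {p : CProj d} (hp : p ∈ S) :
    p.rep ∈ coneOver S :=
  ⟨p.rep_nonzero, by rwa [p.mk_rep]⟩

/-- The homogeneous ideal of a set of points of projective space. -/
def coneIdeal {d : ℕ} (S : Set (CProj d)) : Ideal (MvPolynomial (Fin (d + 1)) ℂ) :=
  vanishingIdeal ℂ (coneOver S)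

theorem mem_coneIdeal {d : ℕ} {S : Set (CProj d)} {f : MvPolynomial (Fin (d + 1)) ℂ} :
    f ∈ coneIdeal S ↔ ∀ v ∈ coneOver S, eval v f = 0 := by
  simp [coneIdeal, mem_vanishingIdeal_iff, aeval_eq_eval]

theorem coneIdeal_anti {d : ℕ} {S T : Set (CProj d)} (h : S ⊆ T) : coneIdeal T ≤ coneIdeal S :=
  vanishingIdeal_anti_mono (coneOver_mono h)

theorem mem_coneIdeal_of_isHomogeneous {d n : ℕ} {S : Set (CProj d)}
    {f : MvPolynomial (Fin (d + 1)) ℂ} (hf : f.IsHomogeneous n) :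
    f ∈ coneIdeal S ↔ ∀ p ∈ S, eval p.rep f = 0 := by
  rw [mem_coneIdeal]
  refine ⟨fun h p hp => h _ (rep_mem_coneOver hp), fun h v ⟨hv, hvS⟩ => ?_⟩
  exact (eval_rep_eq_zero_iff hf v hv).1 (h _ hvS)

/-- The cone is stable under scaling by `a ≠ 0`. So `f (a v)`, a polynomial in `a` whose
coefficients are the values at `v` of the components of `f`, has infinitely many roots and is zero.
-/
theorem homogeneousComponent_mem_coneIdeal {d : ℕ} {S : Set (CProj d)}
    {f : MvPolynomial (Fin (d + 1)) ℂ} (hf : f ∈ coneIdeal S) (n : ℕ) :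
    homogeneousComponent n f ∈ coneIdeal S := by
  rw [mem_coneIdeal] at hf ⊢
  intro v hv
  let q : Polynomial ℂ := ∑ i ∈ Finset.range (f.totalDegree + 1),
    Polynomial.monomial i (eval v (homogeneousComponent i f))
  have hq : q = 0 := by
    refine Polynomial.eq_zero_of_infinite_isRoot q (Set.Infinite.mono ?_
      (Set.finite_singleton (0 : ℂ)).infinite_compl)
    intro a ha
    have h1 := hf _ (smul_mem_coneOver ha hv)
    rw [← sum_homogeneousComponent f, map_sum] at h1
    simp only [Set.mem_ofPred_eq, Polynomial.IsRoot, q, Polynomial.eval_finsetSum,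
      Polynomial.eval_monomial]
    rw [← h1]
    refine Finset.sum_congr rfl fun i _ => ?_
    rw [eval_smul_of_isHomogeneous (homogeneousComponent_isHomogeneous i f), mul_comm]
  by_cases hn : n ≤ f.totalDegree
  · have h2 := congrArg (fun r => Polynomial.coeff r n) hq
    simpa [q, Polynomial.finsetSum_coeff, Polynomial.coeff_monomial, Nat.lt_succ_iff, hn]
      using h2
  · rw [homogeneousComponent_eq_zero n f (not_le.1 hn), map_zero]

theorem isHomogeneous_coneIdeal {d : ℕ} (S : Set (CProj d)) :
    (coneIdeal S).IsHomogeneous (homogeneousSubmodule (Fin (d + 1)) ℂ) := by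
  intro n f hf
  have e : (DirectSum.decompose (homogeneousSubmodule (Fin (d + 1)) ℂ) f n :
      MvPolynomial (Fin (d + 1)) ℂ) = homogeneousComponent n f := decomposition.decompose'_apply f n
  rw [e]
  exact homogeneousComponent_mem_coneIdeal hf n

theorem zeroLocus_coneIdeal {d : ℕ} {S : Set (CProj d)} (hS : IsAlgebraic S) {p : CProj d} :
    p ∈ S ↔ ∀ f ∈ coneIdeal S, eval p.rep f = 0 := by
  refine ⟨fun hp f hf => mem_coneIdeal.1 hf _ (rep_mem_coneOver hp), fun h => ?_⟩
  obtain ⟨F, hF, rfl⟩ := hS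
  intro f hf
  obtain ⟨n, hn⟩ := hF f hf
  exact h f ((mem_coneIdeal_of_isHomogeneous hn).2 fun q hq => hq f hf)

/-! ### From Krull dimension in the Zariski topology to chains of primes. -/

section Zariski

attribute [local instance] zariski

/-- Primality of a homogeneous ideal can be tested on forms; if `f * g` vanishes on `S`, the closed
zero loci of `f` and `g` cover `S`, and irreducibility selects one. -/
theorem isPrime_coneIdeal {d : ℕ} {S : Set (CProj d)} (hS : IsIrreducible S) :
    (coneIdeal S).IsPrime := by
  refine (isHomogeneous_coneIdeal S).isPrime_of_homogeneous_mem_or_mem ?_ ?_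
  · rw [Ne, Ideal.eq_top_iff_one, mem_coneIdeal]
    obtain ⟨p, hp⟩ := hS.nonempty
    intro h
    simpa using h _ (rep_mem_coneOver hp)
  · rintro f g ⟨m, hf⟩ ⟨n, hg⟩ hfg
    rw [mem_homogeneousSubmodule] at hf hg
    have hcl {m : ℕ} {f : MvPolynomial (Fin (d + 1)) ℂ} (hf : f.IsHomogeneous m) :
        IsClosed (zeroLocus ({f} : Set (MvPolynomial (Fin (d + 1)) ℂ))) :=
      (isClosed_zariski_iff _).2 ⟨{f}, by rintro _ rfl; exact ⟨m, hf⟩, rfl⟩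
    rw [mem_coneIdeal_of_isHomogeneous (hf.mul hg)] at hfg
    rw [mem_coneIdeal_of_isHomogeneous hf, mem_coneIdeal_of_isHomogeneous hg]
    have := isPreirreducible_iff_isClosed_union_isClosed.1 hS.isPreirreducible _ _ (hcl hf) (hcl hg)
      (fun p hp => by
        have := hfg p hp
        rw [map_mul, mul_eq_zero] at this
        exact this.imp (fun h => by rintro _ rfl; exact h) (fun h => by rintro _ rfl; exact h))
    exact this.imp (fun h p hp => h hp f rfl) (fun h p hp => h hp g rfl)

/-- A closed irreducible subset of projective space of dimension `k` has a cone of dimension at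
least `k + 1`. -/
theorem exists_ltSeries_primeSpectrum {d k : ℕ} {Y : Type} [TopologicalSpace Y] {j : Y → CProj d}
    (hj : Topology.IsInducing j) (hk : topologicalKrullDim Y = k) :
    ∃ s : LTSeries (PrimeSpectrum (MvPolynomial (Fin (d + 1)) ℂ)),
      s.length = k + 1 ∧ coneIdeal (Set.range j) ≤ s.head.asIdeal := by
  let F : (TopologicalSpace.IrreducibleCloseds Y)ᵒᵈ →
      PrimeSpectrum (MvPolynomial (Fin (d + 1)) ℂ) := fun A =>
    ⟨coneIdeal (j '' ↑(OrderDual.ofDual A)),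
      isPrime_coneIdeal ((OrderDual.ofDual A).isIrreducible.image j hj.continuous.continuousOn)⟩
  have hF : StrictMono F := by
    intro A B hAB
    have hlt : OrderDual.ofDual B < OrderDual.ofDual A := hAB
    refine lt_of_le_of_ne (coneIdeal_anti (Set.image_mono hlt.le)) fun heq => ?_
    have heq' : coneIdeal (j '' ↑(OrderDual.ofDual A)) =
      coneIdeal (j '' ↑(OrderDual.ofDual B)) := congrArg PrimeSpectrum.asIdeal heq
    refine not_le_of_gt hlt fun y hy => ?_
    obtain ⟨T, hT, hTB⟩ := hj.isClosed_iff.1 (OrderDual.ofDual B).isClosed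
    have hTB' : j '' ↑(OrderDual.ofDual B) ⊆ T := by
      rw [← hTB]; exact Set.image_preimage_subset _ _
    rw [← SetLike.mem_coe, ← hTB]
    refine (zeroLocus_coneIdeal ((isClosed_zariski_iff T).1 hT)).2 fun f hf => ?_
    have h1 := coneIdeal_anti hTB' hf
    rw [← heq', mem_coneIdeal] at h1
    exact h1 _ (rep_mem_coneOver ⟨y, hy, rfl⟩)
  obtain ⟨l, hl⟩ := Order.le_krullDim_iff.1
    ((Order.krullDim_orderDual (α := TopologicalSpace.IrreducibleCloseds Y)).trans hk).ge
  -- The extra step in the chain is the vertex of the cone: every cone ideal of a nonempty set is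
  -- strictly contained in the maximal ideal of the origin.
  have hlast : (l.map F hF).last <
      (⟨vanishingIdeal ℂ {(0 : Fin (d + 1) → ℂ)}, inferInstance⟩ : PrimeSpectrum (MvPolynomial (Fin (d + 1)) ℂ)) := by
    rw [LTSeries.last_map]
    obtain ⟨y, hy⟩ := (OrderDual.ofDual l.last).isIrreducible.nonempty
    have hy' : j y ∈ j '' ↑(OrderDual.ofDual l.last) := ⟨y, hy, rfl⟩
    change coneIdeal (j '' ↑(OrderDual.ofDual l.last)) < vanishingIdeal ℂ {(0 : Fin (d + 1) → ℂ)}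
    refine SetLike.lt_iff_le_and_exists.2 ⟨fun f hf => ?_, ?_⟩
    · have := mem_coneIdeal.1 (homogeneousComponent_mem_coneIdeal hf 0) _ (rep_mem_coneOver hy')
      rw [mem_vanishingIdeal_singleton_iff, aeval_eq_eval]
      rw [homogeneousComponent_zero, eval_C] at this
      simpa [constantCoeff_eq] using this
    · obtain ⟨i, hi⟩ := Function.ne_iff.1 (j y).rep_nonzero
      refine ⟨X i, by simp, fun h => hi ?_⟩
      simpa using mem_coneIdeal.1 h _ (rep_mem_coneOver hy')
  refine ⟨(l.map F hF).snoc _ hlast, by simp [hl], ?_⟩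
  rw [RelSeries.head_snoc, LTSeries.head_map]
  exact coneIdeal_anti (Set.image_subset_range _ _)

/-- Let `π` be a projection to a projective space of dimension `k + 1` whose center does not meet a
variety of pure dimension `k`. The image of an irreducible component is the zero set of a form. -/
theorem exists_form_of_isPureDim {d k : ℕ} {X : Set (CProj d)} (hX : IsAlgebraic X)
    (hdim : IsPureDim X k) (π : (Fin (d + 1) → ℂ) →ₗ[ℂ] (Fin (k + 2) → ℂ))
    (h0 : ∀ x ∈ coneOver X, π x ≠ 0) {v : Fin (d + 1) → ℂ} (hv : v ∈ coneOver X) :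
    ∃ (D : ℕ) (f : MvPolynomial (Fin (k + 2)) ℂ), f.IsHomogeneous D ∧ eval (π v) f = 0 ∧
      ∀ y, y ≠ 0 → eval y f = 0 → ∃ x ∈ coneOver X, π x = y := by
  obtain ⟨hv0, hvX⟩ := hv
  set p : X := ⟨Projectivization.mk ℂ v hv0, hvX⟩
  set Z : Set X := irreducibleComponent p with hZ
  have hZk : topologicalKrullDim Z = k := hdim Z (irreducibleComponent_mem_irreducibleComponents p)
  have hind : Topology.IsInducing (fun z : Z => ((z : X) : CProj d)) :=
    Topology.IsInducing.subtypeVal.comp Topology.IsInducing.subtypeVal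
  obtain ⟨s, hs, hsP⟩ := exists_ltSeries_primeSpectrum hind hZk
  have hrange : Set.range (fun z : Z => ((z : X) : CProj d)) = Subtype.val '' Z := by
    ext q; simp
  rw [hrange] at hsP
  have hirr : IsIrreducible (Subtype.val '' Z : Set (CProj d)) :=
    isIrreducible_irreducibleComponent.image _ continuous_subtype_val.continuousOn
  have hcl : IsAlgebraic (Subtype.val '' Z : Set (CProj d)) :=
    (isClosed_zariski_iff _).1 (isClosed_irreducibleComponent.trans
      ((isClosed_zariski_iff X).2 hX))
  have hzero (x : Fin (d + 1) → ℂ) (hx : ∀ f ∈ coneIdeal (Subtype.val '' Z : Set (CProj d)),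
      eval x f = 0) (hx0 : x ≠ 0) : x ∈ coneOver X := by
    refine coneOver_mono (Subtype.coe_image_subset X Z) ⟨hx0, ?_⟩
    obtain ⟨F, hF, hFZ⟩ := hcl
    rw [hFZ]
    intro f hf
    obtain ⟨n, hn⟩ := hF f hf
    rw [eval_rep_eq_zero_iff hn]
    refine hx f ((mem_coneIdeal_of_isHomogeneous hn).2 fun q hq => ?_)
    rw [hFZ] at hq
    exact hq f hf
  have := isPrime_coneIdeal hirr
  -- The dimension count is tight: the chain has length `k + 1` and the target has `k + 2`
  -- coordinates.
  obtain ⟨D, f, hf, hfy⟩ := exists_form_image_eq (π := π) (isHomogeneous_coneIdeal _)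
    (fun x hx hπ => by
      by_contra hx0
      exact h0 x (hzero x hx hx0) hπ) s (by simp [hs]) hsP
  refine ⟨D, f, hf, (hfy _).2 ⟨v, fun g hg => ?_, rfl⟩, fun y hy hfy0 => ?_⟩
  · exact mem_coneIdeal.1 hg v ⟨hv0, ⟨p, mem_irreducibleComponent, rfl⟩⟩
  · obtain ⟨x, hx, rfl⟩ := (hfy y).1 hfy0
    refine ⟨x, hzero x hx ?_, rfl⟩
    rintro rfl
    exact hy (map_zero π)

end Zariski

/-! ### Continuity of the roots of a form along a family of lines. -/

section Roots

variable {σ : Type}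

/-- The restriction of a polynomial to a parametrized line. -/
def lineRestrict (f : MvPolynomial σ ℂ) (q e : σ → ℂ) : Polynomial ℂ :=
  aeval (fun i => Polynomial.C (q i) + Polynomial.C (e i) * Polynomial.X) f

theorem eval_lineRestrict (f : MvPolynomial σ ℂ) (q e : σ → ℂ) (t : ℂ) :
    (lineRestrict f q e).eval t = eval (q + t • e) f := by
  rw [← Polynomial.coe_aeval_eq_eval, lineRestrict, ← aeval_eq_eval, ← AlgHom.comp_apply]
  congr 1
  ext i
  rw [AlgHom.comp_apply, aeval_X, aeval_X, Polynomial.coe_aeval_eq_eval, Polynomial.eval_add,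
    Polynomial.eval_mul, Polynomial.eval_C, Polynomial.eval_C, Polynomial.eval_X, Pi.add_apply,
    Pi.smul_apply, smul_eq_mul, mul_comm]

theorem natDegree_lineRestrict_le {f : MvPolynomial σ ℂ} {D : ℕ} (hf : f.IsHomogeneous D)
    (q e : σ → ℂ) : (lineRestrict f q e).natDegree ≤ D := by
  have := aeval_natDegree_le f hf.totalDegree_le
    (fun i => Polynomial.C (q i) + Polynomial.C (e i) * Polynomial.X) (n := 1) (fun i => by
      compute_degree)
  rwa [mul_one] at this

variable [Fintype σ]

/-- Homogeneity and `e + u q = u (q + u⁻¹ e)` show that reversing the coefficients exchanges base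
point and direction. The top coefficient is thus the value at `e`, so the degree stays `D` while `f`
is nonzero there. -/
theorem reflect_lineRestrict {f : MvPolynomial σ ℂ} {D : ℕ} (hf : f.IsHomogeneous D)
    (q e : σ → ℂ) : (lineRestrict f q e).reflect D = lineRestrict f e q := by
  refine Polynomial.eq_of_infinite_eval_eq _ _ (Set.Infinite.mono ?_
    (Set.finite_singleton (0 : ℂ)).infinite_compl)
  intro u (hu : u ≠ 0)
  have hu' : u⁻¹ ≠ 0 := inv_ne_zero hu
  let _ := invertibleOfNonzero hu'
  have h := Polynomial.eval₂_reflect_mul_pow (RingHom.id ℂ) u⁻¹ D _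
    (natDegree_lineRestrict_le hf q e)
  rw [invOf_eq_inv, inv_inv, Polynomial.eval₂_id, Polynomial.eval₂_id, eval_lineRestrict] at h
  change _ = Polynomial.eval _ _
  rw [eval_lineRestrict, show e + u • q = u • (q + u⁻¹ • e) by
    rw [smul_add, smul_smul, mul_inv_cancel₀ hu, one_smul, add_comm],
    eval_smul_of_isHomogeneous hf, ← h, mul_left_comm, ← mul_pow, mul_inv_cancel₀ hu, one_pow,
    mul_one]

theorem coeff_lineRestrict {f : MvPolynomial σ ℂ} {D : ℕ} (hf : f.IsHomogeneous D)
    (q e : σ → ℂ) : (lineRestrict f q e).coeff D = eval e f := by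
  have h := congrArg (fun p => Polynomial.coeff p 0) (reflect_lineRestrict hf q e)
  simp only [Polynomial.coeff_reflect, Polynomial.revAt_zero] at h
  rw [h, Polynomial.coeff_zero_eq_eval_zero, eval_lineRestrict, zero_smul, add_zero]

/-- The restriction to the line splits as its leading coefficient `f e` times `D` linear factors,
each of norm at least `ε` at `t₀`. -/
theorem norm_eval_ge_of_roots_far {f : MvPolynomial σ ℂ} {D : ℕ} (hf : f.IsHomogeneous D)
    {q e : σ → ℂ} (he : eval e f ≠ 0) {t₀ : ℂ} {ε : ℝ} (hε : 0 ≤ ε)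
    (h : ∀ t, eval (q + t • e) f = 0 → ε ≤ ‖t₀ - t‖) :
    ‖eval e f‖ * ε ^ D ≤ ‖eval (q + t₀ • e) f‖ := by
  set F := lineRestrict f q e with hF
  have hdeg : F.natDegree = D := by
    refine le_antisymm (natDegree_lineRestrict_le hf q e) (Polynomial.le_natDegree_of_ne_zero ?_)
    rwa [coeff_lineRestrict hf]
  have hlead : F.leadingCoeff = eval e f := by
    rw [Polynomial.leadingCoeff, hdeg, coeff_lineRestrict hf]
  have hs : F.Splits := IsAlgClosed.splits F
  rw [← eval_lineRestrict, ← hF, hs.eval_eq_prod_roots, hlead, norm_mul]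
  refine mul_le_mul_of_nonneg_left ?_ (norm_nonneg _)
  rw [← hdeg, hs.natDegree_eq_card_roots]
  have hroot : ∀ t ∈ F.roots, ε ≤ ‖t₀ - t‖ := fun t ht => h t (by
    rw [← eval_lineRestrict]; exact (Polynomial.mem_roots'.1 ht).2)
  generalize F.roots = s at hroot
  induction s using Multiset.induction_on with
  | empty => simp
  | cons a s ih =>
    rw [Multiset.card_cons, Multiset.map_cons, Multiset.prod_cons, norm_mul, pow_succ']
    exact mul_le_mul (hroot a (Multiset.mem_cons_self _ _))
      (ih fun t ht => hroot t (Multiset.mem_cons_of_mem ht)) (pow_nonneg hε _) (norm_nonneg _)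

variable {T : Type} [TopologicalSpace T] {f : MvPolynomial σ ℂ} {D : ℕ} {q e : T → σ → ℂ}

/-- Roots of a continuous family of polynomials of constant degree persist. -/
theorem eventually_exists_root_near (hf : f.IsHomogeneous D) (hq : Continuous q)
    (he : Continuous e) {s₀ : T} (hes : eval (e s₀) f ≠ 0) {t₀ : ℂ}
    (ht₀ : eval (q s₀ + t₀ • e s₀) f = 0) {ε : ℝ} (hε : 0 < ε) :
    ∀ᶠ s in 𝓝 s₀, ∃ t, ‖t₀ - t‖ < ε ∧ eval (q s + t • e s) f = 0 := by
  have hc : Continuous fun s => ‖eval (e s) f‖ * ε ^ D - ‖eval (q s + t₀ • e s) f‖ :=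
    (((MvPolynomial.continuous_eval f).comp he).norm.mul continuous_const).sub
      ((MvPolynomial.continuous_eval f).comp (hq.add (he.const_smul t₀))).norm
  have h0 : 0 < ‖eval (e s₀) f‖ * ε ^ D - ‖eval (q s₀ + t₀ • e s₀) f‖ := by
    rw [ht₀, norm_zero, sub_zero]
    exact mul_pos (norm_pos_iff.2 hes) (pow_pos hε D)
  have hne : ∀ᶠ s in 𝓝 s₀, eval (e s) f ≠ 0 :=
    ((MvPolynomial.continuous_eval f).comp he).continuousAt.eventually_ne hes
  filter_upwards [hc.continuousAt.eventually_const_lt h0, hne] with s hs hns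
  by_contra! hcon
  have := norm_eval_ge_of_roots_far hf hns hε.le (t₀ := t₀)
    fun t ht => not_lt.1 fun hlt => hcon t hlt ht
  linarith

theorem isOpen_exists_root_upper (hf : f.IsHomogeneous D) (hq : Continuous q)
    (he : Continuous e) (hes : ∀ s, eval (e s) f ≠ 0) :
    IsOpen {s | ∃ t : ℂ, 0 < t.im ∧ eval (q s + t • e s) f = 0} := by
  rw [isOpen_iff_mem_nhds]
  rintro s₀ ⟨t₀, ht, ht₀⟩
  filter_upwards [eventually_exists_root_near hf hq he (hes s₀) ht₀ ht] with s ⟨t, hts, h⟩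
  refine ⟨t, ?_, h⟩
  have := (Complex.abs_im_le_norm (t₀ - t)).trans_lt hts
  rw [Complex.sub_im, abs_lt] at this
  linarith

theorem isClosed_exists_root_upper (hf : f.IsHomogeneous D) (hq : Continuous q)
    (he : Continuous e) (hes : ∀ s, eval (e s) f ≠ 0)
    (hreal : ∀ s (t : ℂ), t.im = 0 → eval (q s + t • e s) f ≠ 0) :
    IsClosed {s | ∃ t : ℂ, 0 < t.im ∧ eval (q s + t • e s) f = 0} := by
  rw [← isOpen_compl_iff, isOpen_iff_mem_nhds]
  intro s₀ hs₀
  have hs₀' : ∀ t : ℂ, 0 ≤ t.im → eval (q s₀ + t • e s₀) f ≠ 0 := by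
    intro t ht h
    rcases ht.eq_or_lt with h0 | h0
    · exact hreal s₀ t h0.symm h
    · exact hs₀ ⟨t, h0, h⟩
  -- Large roots `t` correspond to small zeros `u = t⁻¹` of `f (e + u q)`, which is nonzero near
  -- `(s₀, 0)`. The remaining roots are handled on a compact half disc.
  have hbd : ∃ R : ℝ, ∀ᶠ s in 𝓝 s₀, ∀ t : ℂ, eval (q s + t • e s) f = 0 → ‖t‖ ≤ R := by
    have hc : Continuous fun z : T × ℂ => eval (e z.1 + z.2 • q z.1) f :=
      (MvPolynomial.continuous_eval f).comp
        ((he.comp continuous_fst).add (continuous_snd.smul (hq.comp continuous_fst)))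
    have h1 : ∀ᶠ z in 𝓝 (s₀, (0 : ℂ)), eval (e z.1 + z.2 • q z.1) f ≠ 0 :=
      hc.continuousAt.eventually_ne (by simpa using hes s₀)
    rw [nhds_prod_eq, Filter.eventually_prod_iff] at h1
    obtain ⟨p, hp, r, hr, hpr⟩ := h1
    obtain ⟨δ, hδ, hball⟩ := Metric.eventually_nhds_iff_ball.1 hr
    refine ⟨δ⁻¹, hp.mono fun s hs t ht => ?_⟩
    by_contra! hlt
    have ht0 : t ≠ 0 := norm_pos_iff.1 ((inv_pos.2 hδ).trans hlt)
    have hu : t⁻¹ ∈ Metric.ball (0 : ℂ) δ := by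
      rw [mem_ball_zero_iff, norm_inv]
      exact inv_lt_of_inv_lt₀ hδ hlt
    refine hpr hs (hball _ hu) ?_
    have : e s + t⁻¹ • q s = t⁻¹ • (q s + t • e s) := by
      rw [smul_add, smul_smul, inv_mul_cancel₀ ht0, one_smul, add_comm]
    simp only [this, eval_smul_of_isHomogeneous hf, ht, mul_zero]
  obtain ⟨R, hR⟩ := hbd
  have hK : IsCompact (Metric.closedBall (0 : ℂ) R ∩ {t | 0 ≤ t.im}) :=
    (isCompact_closedBall _ _).inter_right (isClosed_le continuous_const Complex.continuous_im)
  have hc : Continuous fun z : T × ℂ => eval (q z.1 + z.2 • e z.1) f :=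
    (MvPolynomial.continuous_eval f).comp
      ((hq.comp continuous_fst).add (continuous_snd.smul (he.comp continuous_fst)))
  have h2 := hK.eventually_forall_of_forall_eventually (x₀ := s₀)
    (P := fun s t => eval (q s + t • e s) f ≠ 0)
    fun t ht => hc.continuousAt.eventually_ne (hs₀' t ht.2)
  filter_upwards [hR, h2] with s hs1 hs2
  rintro ⟨t, ht, htf⟩
  exact hs2 t ⟨by simpa using hs1 t htf, ht.le⟩ htf

/-- Roots cannot leave the upper half plane when they neither cross the real axis nor escape to
infinity. -/
theorem exists_root_upper_of_preconnected [PreconnectedSpace T] (hf : f.IsHomogeneous D)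
    (hq : Continuous q) (he : Continuous e) (hes : ∀ s, eval (e s) f ≠ 0)
    (hreal : ∀ s (t : ℂ), t.im = 0 → eval (q s + t • e s) f ≠ 0) {s₁ : T}
    (h₁ : ∃ t : ℂ, 0 < t.im ∧ eval (q s₁ + t • e s₁) f = 0) (s : T) :
    ∃ t : ℂ, 0 < t.im ∧ eval (q s + t • e s) f = 0 := by
  have h : IsClopen {s | ∃ t : ℂ, 0 < t.im ∧ eval (q s + t • e s) f = 0} :=
    ⟨isClosed_exists_root_upper hf hq he hes hreal, isOpen_exists_root_upper hf hq he hes⟩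
  exact (h.eq_univ ⟨s₁, h₁⟩).ge (Set.mem_univ s)

end Roots

section

/-! Real and imaginary parts of complex vectors. -/

/-- The real part of a complex vector. -/
def reVec (d : ℕ) : (Fin (d + 1) → ℂ) →ₗ[ℝ] RVec d where
  toFun z := WithLp.toLp 2 fun i => (z i).re
  map_add' z w := by ext i; simp
  map_smul' c z := by ext i; simp

/-- The imaginary part of a complex vector. -/
def imVec (d : ℕ) : (Fin (d + 1) → ℂ) →ₗ[ℝ] RVec d where
  toFun z := WithLp.toLp 2 fun i => (z i).im
  map_add' z w := by ext i; simp
  map_smul' c z := by ext i; simp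

variable {d : ℕ}

theorem reVec_smul_toC (c : ℂ) (v : RVec d) : reVec d (c • toC d v) = c.re • v := by
  ext i; simp [reVec, toC]

theorem imVec_smul_toC (c : ℂ) (v : RVec d) : imVec d (c • toC d v) = c.im • v := by
  ext i; simp [imVec, toC]

theorem imVec_toC (v : RVec d) : imVec d (toC d v) = 0 := by
  ext i; simp [imVec, toC]

theorem imVec_smul (c : ℂ) (z : Fin (d + 1) → ℂ) :
    imVec d (c • z) = c.re • imVec d z + c.im • reVec d z := by
  ext i; simp [imVec, reVec]

theorem reVec_smul (c : ℂ) (z : Fin (d + 1) → ℂ) :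
    reVec d (c • z) = c.re • reVec d z - c.im • imVec d z := by
  ext i; simp [imVec, reVec]

theorem toC_reVec_add (z : Fin (d + 1) → ℂ) :
    toC d (reVec d z) + Complex.I • toC d (imVec d z) = z := by
  ext i
  simp [toC, reVec, imVec, mul_comm Complex.I, Complex.re_add_im]

theorem continuous_toC (d : ℕ) : Continuous (toC d) := by
  refine continuous_pi fun i => ?_
  change Continuous fun v : RVec d => ((v i : ℝ) : ℂ)
  fun_prop

theorem toC_mem_complexify {W : Submodule ℝ (RVec d)} {v : RVec d} (hv : v ∈ W) :
    toC d v ∈ complexify W :=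
  Submodule.subset_span ⟨v, hv, rfl⟩

theorem mem_complexify_iff {W : Submodule ℝ (RVec d)} {z : Fin (d + 1) → ℂ} :
    z ∈ complexify W ↔ reVec d z ∈ W ∧ imVec d z ∈ W := by
  refine ⟨fun h => ?_, fun h => ?_⟩
  · induction h using Submodule.span_induction with
    | mem x hx =>
      obtain ⟨v, hv, rfl⟩ := hx
      rw [imVec_toC, ← one_smul ℂ (toC d v), reVec_smul_toC, Complex.one_re, one_smul]
      exact ⟨hv, W.zero_mem⟩
    | zero => simp
    | add x y _ _ hx hy =>
      rw [map_add, map_add]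
      exact ⟨W.add_mem hx.1 hy.1, W.add_mem hx.2 hy.2⟩
    | smul c x _ hx =>
      rw [reVec_smul, imVec_smul]
      exact ⟨W.sub_mem (W.smul_mem _ hx.1) (W.smul_mem _ hx.2),
        W.add_mem (W.smul_mem _ hx.2) (W.smul_mem _ hx.1)⟩
  · rw [← toC_reVec_add z]
    exact Submodule.add_mem _ (toC_mem_complexify h.1)
      (Submodule.smul_mem _ _ (toC_mem_complexify h.2))

theorem complexify_mono {W W' : Submodule ℝ (RVec d)} (h : W ≤ W') :
    complexify W ≤ complexify W' :=
  Submodule.span_mono (Set.image_mono h)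

/-- A linear projection with a given complex center defined over the reals. -/
theorem exists_projection {n : ℕ} (W : Submodule ℝ (RVec d))
    (hW : Module.finrank ℝ W + n = d + 1) :
    ∃ π : (Fin (d + 1) → ℂ) →ₗ[ℂ] (Fin n → ℂ), LinearMap.ker π = complexify W := by
  have h := (complexify W).finrank_quotient_add_finrank
  rw [finrank_complexify, Module.finrank_fin_fun] at h
  have h' : Module.finrank ℂ ((Fin (d + 1) → ℂ) ⧸ complexify W) =
      Module.finrank ℂ (Fin n → ℂ) := by
    rw [Module.finrank_fin_fun]; omega
  refine ⟨(LinearEquiv.ofFinrankEq _ _ h').toLinearMap ∘ₗ (complexify W).mkQ, ?_⟩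
  rw [LinearEquiv.ker_comp, Submodule.ker_mkQ]

theorem IsRealSubvariety.isAlgebraic {X : Set (CProj d)} (hX : IsRealSubvariety X) :
    IsAlgebraic X := by
  obtain ⟨S, hS, rfl⟩ := hX
  refine ⟨_, ?_, rfl⟩
  rintro _ ⟨f, hf, rfl⟩
  obtain ⟨n, hn⟩ := hS f hf
  exact ⟨n, hn.map _⟩

/-! Hyperbolicity in terms of imaginary parts. -/

/-- Every point of `X` whose homogeneous coordinates have imaginary part in `W` is real. -/
def ImHyperbolic (X : Set (CProj d)) (W : Submodule ℝ (RVec d)) : Prop :=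
  ∀ z ∈ coneOver X, imVec d z ∈ W → imVec d z = 0

/-- If `z` lies in the complexification, the hypothesis applies to both `z` and `i z` and kills the
imaginary and the real part. -/
theorem ImHyperbolic.notMem_complexify {X : Set (CProj d)} {W : Submodule ℝ (RVec d)}
    (h : ImHyperbolic X W) {z : Fin (d + 1) → ℂ} (hz : z ∈ coneOver X) : z ∉ complexify W := by
  intro hzW
  have hzW' := mem_complexify_iff.1 hzW
  have h1 := h z hz hzW'.2
  have h2 := h _ (smul_mem_coneOver Complex.I_ne_zero hz) (by
    rw [imVec_smul]; simpa using hzW'.1)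
  rw [imVec_smul] at h2
  have h3 : reVec d z = 0 := by simpa using h2
  refine hz.1 ?_
  rw [← toC_reVec_add z, h1, h3]
  simp

theorem mk_mem_linearPoints {W : Submodule ℂ (Fin (d + 1) → ℂ)} {z : Fin (d + 1) → ℂ}
    (hz : z ≠ 0) : Projectivization.mk ℂ z hz ∈ linearPoints W ↔ z ∈ W := by
  rw [linearPoints, Set.mem_ofPred_eq, Projectivization.submodule_mk,
    Submodule.span_singleton_le_iff_mem]

theorem points_inter_eq_empty_iff {m : ℕ} {X : Set (CProj d)} {V : RGrass m d} :
    V.toCGrass.points ∩ X = ∅ ↔ ∀ z ∈ coneOver X, z ∉ complexify V.1 := by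
  rw [Set.eq_empty_iff_forall_notMem]
  refine ⟨fun h z ⟨hz, hzX⟩ hzV => h _ ⟨(mk_mem_linearPoints hz).2 hzV, hzX⟩, ?_⟩
  rintro h p ⟨hpV, hpX⟩
  refine h p.rep (rep_mem_coneOver hpX) ((mk_mem_linearPoints p.rep_nonzero).1 ?_)
  rwa [p.mk_rep]

theorem finrank_sup_span_singleton {W : Submodule ℝ (RVec d)} {u : RVec d} (hu : u ∉ W) :
    Module.finrank ℝ ↥(W ⊔ Submodule.span ℝ {u}) = Module.finrank ℝ W + 1 := by
  have hu0 : u ≠ 0 := fun h => hu (h ▸ W.zero_mem)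
  have h := Submodule.finrank_sup_add_finrank_inf_eq W (Submodule.span ℝ {u})
  rwa [((Submodule.disjoint_span_singleton' hu0).2 hu).eq_bot, finrank_bot, add_zero,
    finrank_span_singleton hu0] at h

theorem mk_mem_realLocus_of_imVec_eq_zero {z : Fin (d + 1) → ℂ} (hz : z ≠ 0)
    (h : imVec d z = 0) : Projectivization.mk ℂ z hz ∈ realLocus d := by
  have h1 : toC d (reVec d z) = z := by
    conv_rhs => rw [← toC_reVec_add z, h, map_zero, smul_zero, add_zero]
  have h2 : reVec d z ≠ 0 := fun h0 => hz (by rw [← h1, h0, map_zero])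
  refine ⟨Projectivization.mk ℝ (reVec d z) h2, ?_⟩
  rw [Projectivization.map_mk]
  simp only [h1]

/-- A point with imaginary part in `V` lies on `U = V + ⟨re z⟩`. Conversely, a point of some `U`
containing `V` as a hyperplane can be rescaled so that its imaginary part falls into `V`. -/
theorem isHyperbolic_iff {ℓ : ℕ} {X : Set (CProj d)} {V : RGrass ℓ d} :
    IsHyperbolic X V ↔ ImHyperbolic X V.1 := by
  refine ⟨fun ⟨h1, h2⟩ z hz hzV => ?_, fun h => ⟨points_inter_eq_empty_iff.2
    fun z hz => h.notMem_complexify hz, fun U hVU p ⟨hpX, hpU⟩ => ⟨hpX, ?_⟩⟩⟩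
  · by_contra him
    have hre : reVec d z ∉ V.1 := fun hre =>
      points_inter_eq_empty_iff.1 h1 z hz (mem_complexify_iff.2 ⟨hre, hzV⟩)
    let U : RGrass (ℓ + 1) d := ⟨V.1 ⊔ Submodule.span ℝ {reVec d z}, by
      rw [finrank_sup_span_singleton hre, V.2]⟩
    obtain ⟨hz0, hzX⟩ := hz
    have hzU : Projectivization.mk ℂ z hz0 ∈ U.toCGrass.points :=
      (mk_mem_linearPoints hz0).2 (mem_complexify_iff.2
        ⟨Submodule.mem_sup_right (Submodule.mem_span_singleton_self _),
          Submodule.mem_sup_left hzV⟩)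
    obtain ⟨-, p, hp⟩ := h2 U le_sup_left ⟨hzX, hzU⟩
    induction p using Projectivization.ind with
    | h r hr =>
      rw [Projectivization.map_mk, Projectivization.mk_eq_mk_iff'] at hp
      obtain ⟨a, ha⟩ := hp
      have ha0 : a ≠ 0 := by
        rintro rfl
        exact hr (toC_injective d (by rw [← ha, zero_smul, map_zero]))
      have hz' : z = a⁻¹ • toC d r := by rw [← ha, smul_smul, inv_mul_cancel₀ ha0, one_smul]
      rw [hz', imVec_smul_toC] at hzV him
      rw [hz', reVec_smul_toC] at hre
      have hne : a⁻¹.im ≠ 0 := fun h0 => him (by rw [h0, zero_smul])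
      exact hre (V.1.smul_mem _ ((V.1.smul_mem_iff hne).1 hzV))
  · obtain ⟨u, huU, huV⟩ : ∃ u ∈ U.1, u ∉ V.1 := by
      by_contra! hcon
      have := Submodule.finrank_mono (show U.1 ≤ V.1 from hcon)
      rw [U.2, V.2] at this
      omega
    have hsup : V.1 ⊔ Submodule.span ℝ {u} = U.1 := by
      refine Submodule.eq_of_le_of_finrank_eq
        (sup_le hVU ((Submodule.span_singleton_le_iff_mem _ _).2 huU)) ?_
      rw [finrank_sup_span_singleton huV, V.2, U.2]
    have hpU' : p.rep ∈ complexify U.1 := (mk_mem_linearPoints p.rep_nonzero).1 (by rwa [p.mk_rep])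
    rw [mem_complexify_iff, ← hsup, Submodule.mem_sup, Submodule.mem_sup] at hpU'
    obtain ⟨⟨v₁, hv₁, y₁, hy₁, h₁⟩, v₂, hv₂, y₂, hy₂, h₂⟩ := hpU'
    obtain ⟨c₁, rfl⟩ := Submodule.mem_span_singleton.1 hy₁
    obtain ⟨c₂, rfl⟩ := Submodule.mem_span_singleton.1 hy₂
    -- With `u`-coordinates `c₁` and `c₂` of the real and imaginary parts, multiplying by `c₁ - i
    -- c₂` cancels the `u`-coordinate of the imaginary part; if this scalar is zero, `a = 1` works.
    obtain ⟨a, ha, haV⟩ : ∃ a : ℂ, a ≠ 0 ∧ imVec d (a • p.rep) ∈ V.1 := by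
      by_cases hc : (⟨c₁, -c₂⟩ : ℂ) = 0
      · refine ⟨1, one_ne_zero, ?_⟩
        have hc2 : c₂ = 0 := by simpa using congrArg Complex.im hc
        rw [one_smul, ← h₂, hc2, zero_smul, add_zero]
        exact hv₂
      · refine ⟨_, hc, ?_⟩
        rw [imVec_smul, ← h₁, ← h₂]
        have : c₁ • (v₂ + c₂ • u) + -c₂ • (v₁ + c₁ • u) = c₁ • v₂ + -c₂ • v₁ := by module
        rw [this]
        exact V.1.add_mem (V.1.smul_mem _ hv₂) (V.1.smul_mem _ hv₁)
    have hne : a • p.rep ≠ 0 := smul_ne_zero ha p.rep_nonzero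
    have hreal := mk_mem_realLocus_of_imVec_eq_zero hne
      (h _ (smul_mem_coneOver ha (rep_mem_coneOver hpX)) haV)
    have hp : Projectivization.mk ℂ (a • p.rep) hne = p := by
      conv_rhs => rw [← p.mk_rep]
      exact (Projectivization.mk_eq_mk_iff' ℂ _ _ _ _).2 ⟨a, rfl⟩
    rwa [hp] at hreal

/-! Moving a real linear subspace in a pencil. -/

section Pencil

variable {k : ℕ} {X : Set (CProj d)} {V₀ : Submodule ℝ (RVec d)} {w w' : RVec d}

/-- The points of the segment between two vectors. -/
def segmentPoint (w w' : RVec d) (s : unitInterval) : RVec d := (1 - s : ℝ) • w + (s : ℝ) • w'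

theorem continuous_segmentPoint (w w' : RVec d) : Continuous (segmentPoint w w') := by
  unfold segmentPoint
  fun_prop

theorem not_imVec_pos_of_imHyperbolic (hX : IsAlgebraic X) (hdim : IsPureDim X k)
    (hV₀ : Module.finrank ℝ V₀ + (k + 2) = d + 1)
    (hmem : ∀ s, segmentPoint w w' s ∉ V₀)
    (havoid : ∀ s, ∀ z ∈ coneOver X,
      z ∉ complexify (V₀ ⊔ Submodule.span ℝ {segmentPoint w w' s}))
    (hw : ImHyperbolic X (V₀ ⊔ Submodule.span ℝ {w}))
    {z : Fin (d + 1) → ℂ} (hz : z ∈ coneOver X) {v₀ : RVec d} (hv₀ : v₀ ∈ V₀) {c : ℝ}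
    (hc : 0 < c) : imVec d z ≠ v₀ + c • w' := by
  intro him
  obtain ⟨π, hπ⟩ := exists_projection V₀ hV₀
  have hw0 : w ∉ V₀ := by simpa [segmentPoint] using hmem 0
  have hker (x y : Fin (d + 1) → ℂ) (h : π x = π y) : imVec d x - imVec d y ∈ V₀ ∧
      x - y ∈ complexify V₀ := by
    have : x - y ∈ complexify V₀ := by rw [← hπ, LinearMap.mem_ker, map_sub, h, sub_self]
    rw [← map_sub]
    exact ⟨(mem_complexify_iff.1 this).2, this⟩
  obtain ⟨D, f, hf, hfz, hfX⟩ := exists_form_of_isPureDim hX hdim π (fun x hx h0 => by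
    refine havoid 0 x hx (complexify_mono le_sup_left ?_)
    rwa [← hπ, LinearMap.mem_ker]) hz
  set e : unitInterval → Fin (k + 2) → ℂ := fun s => π (toC d (segmentPoint w w' s)) with he
  set a := reVec d z with ha
  set q : ℝ → Fin (k + 2) → ℂ := fun α => π (toC d a + (α * Complex.I : ℂ) • toC d w) with hq
  have hπc : Continuous π := π.continuous_of_finiteDimensional
  have hec : Continuous e := hπc.comp ((continuous_toC d).comp (continuous_segmentPoint w w'))
  have hqc : Continuous q := by
    have hs : Continuous fun α : ℝ => (α * Complex.I : ℂ) := by fun_prop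
    exact hπc.comp (continuous_const.add (hs.smul continuous_const))
  have hes : ∀ s, eval (e s) f ≠ 0 := by
    intro s h0
    obtain ⟨x, hx, hxe⟩ := hfX _ (fun h => hmem s (by
      have h' : toC d (segmentPoint w w' s) ∈ complexify V₀ := by rwa [← hπ, LinearMap.mem_ker]
      have := (mem_complexify_iff.1 h').1
      rwa [← one_smul ℂ (toC d _), reVec_smul_toC, Complex.one_re, one_smul] at this)) h0
    refine havoid s x hx ?_
    rw [← sub_add_cancel x (toC d (segmentPoint w w' s))]
    exact Submodule.add_mem _ (complexify_mono le_sup_left (hker _ _ hxe).2)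
      (toC_mem_complexify (Submodule.mem_sup_right (Submodule.mem_span_singleton_self _)))
  -- vectors with imaginary part proportional to `w` do not project to zeros of `f`
  have key : ∀ u : Fin (d + 1) → ℂ, ∀ β : ℝ, β ≠ 0 → imVec d u = β • w → eval (π u) f ≠ 0 := by
    intro u β hβ hu h0
    have hβw : β • w ∉ V₀ := fun h => hw0 ((V₀.smul_mem_iff hβ).1 h)
    obtain ⟨x, hx, hxu⟩ := hfX _ (fun h => hβw (by
      have := (hker u 0 (by rw [h, map_zero])).1
      rwa [map_zero, sub_zero, hu] at this)) h0
    have h1 := (hker x u hxu).1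
    have h2 : imVec d x ∈ V₀ ⊔ Submodule.span ℝ {w} := by
      rw [← sub_add_cancel (imVec d x) (imVec d u)]
      refine Submodule.add_mem _ (Submodule.mem_sup_left h1) (Submodule.mem_sup_right ?_)
      rw [hu]
      exact Submodule.smul_mem _ _ (Submodule.mem_span_singleton_self _)
    rw [hw x hx h2, zero_sub, hu] at h1
    exact hβw (by simpa using V₀.neg_mem h1)
  have hline (α : ℝ) (t : ℂ) (s : unitInterval) : q α + t • e s =
      π (toC d a + (α * Complex.I : ℂ) • toC d w + t • toC d (segmentPoint w w' s)) := by
    simp only [hq, he, map_add, map_smul]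
  have him' (α : ℝ) (t : ℂ) (v : RVec d) :
      imVec d (toC d a + (α * Complex.I : ℂ) • toC d w + t • toC d v) = α • w + t.im • v := by
    rw [map_add, map_add, imVec_toC, imVec_smul_toC, imVec_smul_toC]
    simp
  -- a root in the upper half plane for small positive `α`
  have hroot0 : eval (q 0 + (c * Complex.I : ℂ) • e 1) f = 0 := by
    have h1 : π z = q 0 + (c * Complex.I : ℂ) • e 1 := by
      rw [hline, ← sub_eq_zero, ← map_sub, ← LinearMap.mem_ker, hπ]
      have hzd : z = toC d a + Complex.I • toC d (v₀ + c • w') := by rw [← him, toC_reVec_add]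
      have : z - (toC d a + ((0 : ℝ) * Complex.I : ℂ) • toC d w +
            (c * Complex.I : ℂ) • toC d (segmentPoint w w' 1)) = Complex.I • toC d v₀ := by
        rw [hzd]
        ext i
        simp [segmentPoint, toC]
        ring
      rw [this]
      exact Submodule.smul_mem _ _ (toC_mem_complexify hv₀)
    rwa [← h1]
  have hopen := isOpen_exists_root_upper hf hqc (continuous_const (y := e 1)) fun _ => hes 1
  have h0mem : (0 : ℝ) ∈ {α | ∃ t : ℂ, 0 < t.im ∧ eval (q α + t • e 1) f = 0} :=
    ⟨c * Complex.I, by simpa using hc, hroot0⟩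
  obtain ⟨α, hα, hαroot⟩ : ∃ α : ℝ, 0 < α ∧ ∃ t : ℂ, 0 < t.im ∧ eval (q α + t • e 1) f = 0 := by
    have h1 := hopen.mem_nhds h0mem
    have h2 : ∀ᶠ α in 𝓝[>] (0 : ℝ), ∃ t : ℂ, 0 < t.im ∧ eval (q α + t • e 1) f = 0 :=
      nhdsWithin_le_nhds h1
    obtain ⟨α, h3, h4⟩ := (h2.and self_mem_nhdsWithin).exists
    exact ⟨α, h4, h3⟩
  -- With `α` fixed, `s` runs from `1` to `0`; the final root has imaginary part `(α + t.im) w` with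
  -- positive coefficient, again excluded by `key`.
  obtain ⟨t, ht, htf⟩ := exists_root_upper_of_preconnected hf
    (continuous_const (y := q α)) hec hes (fun s t ht h => by
      rw [hline] at h
      refine key _ α hα.ne' ?_ h
      rw [him', ht, zero_smul, add_zero]) hαroot 0
  rw [hline] at htf
  refine key _ (α + t.im) (by positivity) ?_ htf
  rw [him', add_smul]
  simp [segmentPoint]

/-- Hyperbolicity is preserved when one vector of a spanning set moves along a segment and the
subspace stays away from `X`. -/
theorem ImHyperbolic.of_segment (hX : IsAlgebraic X) (hdim : IsPureDim X k)
    (hV₀ : Module.finrank ℝ V₀ + (k + 2) = d + 1)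
    (hmem : ∀ s, segmentPoint w w' s ∉ V₀)
    (havoid : ∀ s, ∀ z ∈ coneOver X,
      z ∉ complexify (V₀ ⊔ Submodule.span ℝ {segmentPoint w w' s}))
    (hw : ImHyperbolic X (V₀ ⊔ Submodule.span ℝ {w})) :
    ImHyperbolic X (V₀ ⊔ Submodule.span ℝ {w'}) := by
  intro z hz him
  obtain ⟨v₀, hv₀, y, hy, hzv⟩ := Submodule.mem_sup.1 him
  obtain ⟨c, rfl⟩ := Submodule.mem_span_singleton.1 hy
  have hneg (s : unitInterval) : segmentPoint (-w) (-w') s = -segmentPoint w w' s := by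
    simp only [segmentPoint]
    module
  have hspan (v : RVec d) : Submodule.span ℝ {-v} = Submodule.span ℝ {v} := by
    rw [← Set.neg_singleton, Submodule.span_neg_eq_neg, Submodule.neg_eq_self]
  -- A negative coefficient becomes positive after replacing `w` and `w'` by their negatives, which
  -- changes no span.
  rcases lt_trichotomy c 0 with hc | rfl | hc
  · refine absurd hzv.symm ?_
    have := not_imVec_pos_of_imHyperbolic (w := -w) (w' := -w') hX hdim hV₀
      (fun s h => hmem s (by rw [hneg] at h; simpa using h))
      (fun s => by rw [hneg, hspan]; exact havoid s) (by rwa [hspan]) hz hv₀ (neg_pos.2 hc)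
    rwa [neg_smul_neg] at this
  · refine hw z hz ?_
    rw [← hzv, zero_smul, add_zero]
    exact Submodule.mem_sup_left hv₀
  · exact absurd hzv.symm (not_imVec_pos_of_imHyperbolic hX hdim hV₀ hmem havoid hw hz hv₀ hc)

end Pencil

end

/-! ### Local constancy of hyperbolicity on the Grassmannian. -/

section

variable {d k ℓ : ℕ} {X : Set (CProj d)}

/-- The complex linear combinations of the vectors `b i` with coefficients that do not all vanish
are neither zero nor homogeneous coordinates of points of `X`. -/
def Avoids (X : Set (CProj d)) (b : Fin ℓ → RVec d) : Prop :=
  ∀ c : Fin ℓ → ℂ, c ≠ 0 → ∑ i, c i • toC d (b i) ∉ insert 0 (coneOver X)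

theorem isClosed_insert_coneOver (hX : IsAlgebraic X) : IsClosed (insert 0 (coneOver X)) := by
  obtain ⟨S, hS, rfl⟩ := hX
  have : insert 0 (coneOver (zeroLocus S)) = {0} ∪ ⋂ f ∈ S, {v | eval v f = 0} := by
    ext v
    rw [Set.mem_insert_iff, Set.mem_union, Set.mem_singleton_iff]
    refine or_congr_right' fun hv => ?_
    rw [Set.mem_iInter₂]
    refine ⟨fun ⟨_, h⟩ f hf => ?_, fun h => ⟨hv, fun f hf => ?_⟩⟩
    · obtain ⟨n, hn⟩ := hS f hf
      exact (eval_rep_eq_zero_iff hn v hv).1 (h f hf)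
    · obtain ⟨n, hn⟩ := hS f hf
      exact (eval_rep_eq_zero_iff hn v hv).2 (h f hf)
  rw [this]
  exact isClosed_singleton.union (isClosed_biInter fun f _ =>
    isClosed_eq (MvPolynomial.continuous_eval f) continuous_const)

/-- By scaling, only coefficient vectors on the unit sphere matter; that sphere is compact and the
forbidden set is closed. -/
theorem isOpen_avoids (hX : IsAlgebraic X) : IsOpen {b : Fin ℓ → RVec d | Avoids X b} := by
  have hcl := isClosed_insert_coneOver hX
  have hc : Continuous fun z : (Fin ℓ → RVec d) × (Fin ℓ → ℂ) => ∑ i, z.2 i • toC d (z.1 i) := by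
    refine continuous_finsetSum _ fun i _ => ?_
    exact ((continuous_apply i).comp continuous_snd).smul
      ((continuous_toC d).comp ((continuous_apply i).comp continuous_fst))
  rw [isOpen_iff_mem_nhds]
  intro b hb
  have h := (isCompact_sphere (0 : Fin ℓ → ℂ) 1).eventually_forall_of_forall_eventually (x₀ := b)
    (P := fun b c => ∑ i, c i • toC d (b i) ∉ insert 0 (coneOver X))
    fun c hc1 => (hc.continuousAt (x := (b, c))).eventually (hcl.isOpen_compl.mem_nhds
      (show ∑ i, c i • toC d (b i) ∈ (insert 0 (coneOver X))ᶜ from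
        hb c (ne_zero_of_mem_unit_sphere (⟨c, hc1⟩ : Metric.sphere (0 : Fin ℓ → ℂ) 1))))
  filter_upwards [h] with b' hb' c hc0 hmem
  have hn : (‖c‖ : ℂ) ≠ 0 := by exact_mod_cast norm_ne_zero_iff.2 hc0
  refine hb' ((‖c‖ : ℂ)⁻¹ • c) ?_ ?_
  · rw [mem_sphere_zero_iff_norm, norm_smul, norm_inv, Complex.norm_real, norm_norm,
      inv_mul_cancel₀ (norm_ne_zero_iff.2 hc0)]
  · simp only [Pi.smul_apply, smul_eq_mul, mul_smul, ← Finset.smul_sum]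
    rcases hmem with h0 | h0
    · rw [h0, smul_zero]
      exact Set.mem_insert _ _
    · exact Set.mem_insert_of_mem _ (smul_mem_coneOver (inv_ne_zero hn) h0)

theorem Avoids.linearIndependent {b : Fin ℓ → RVec d} (hb : Avoids X b) :
    LinearIndependent ℝ b := by
  rw [Fintype.linearIndependent_iff]
  intro g hg i
  by_contra hi
  refine hb (fun i => (g i : ℂ)) (fun h => hi (by simpa using congrFun h i)) (Or.inl ?_)
  have := congrArg (toC d) hg
  rw [map_sum, map_zero] at this
  simp only [LinearMap.map_smulₛₗ] at this
  exact this

theorem complexify_span_range (b : Fin ℓ → RVec d) :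
    complexify (Submodule.span ℝ (Set.range b)) =
      Submodule.span ℂ (Set.range fun i => toC d (b i)) := by
  refine le_antisymm (Submodule.span_le.2 ?_) (Submodule.span_le.2 ?_)
  · rintro _ ⟨v, hv, rfl⟩
    obtain ⟨c, rfl⟩ := (Submodule.mem_span_range_iff_exists_fun ℝ).1 hv
    rw [map_sum]
    refine Submodule.sum_mem _ fun i _ => ?_
    rw [LinearMap.map_smulₛₗ]
    exact Submodule.smul_mem _ _ (Submodule.subset_span ⟨i, rfl⟩)
  · rintro _ ⟨i, rfl⟩
    exact toC_mem_complexify (Submodule.subset_span ⟨i, rfl⟩)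

theorem Avoids.notMem_complexify {b : Fin ℓ → RVec d} (hb : Avoids X b) {z : Fin (d + 1) → ℂ}
    (hz : z ∈ coneOver X) : z ∉ complexify (Submodule.span ℝ (Set.range b)) := by
  rw [complexify_span_range, Submodule.mem_span_range_iff_exists_fun]
  rintro ⟨c, rfl⟩
  refine hb c ?_ (Or.inr hz)
  rintro rfl
  exact hz.1 (by simp)

theorem avoids_of_linearIndependent {b : Fin ℓ → RVec d} (hb : LinearIndependent ℝ b)
    (h : ∀ z ∈ coneOver X, z ∉ complexify (Submodule.span ℝ (Set.range b))) : Avoids X b := by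
  rintro c hc (h0 | h0)
  · exact hc (funext (Fintype.linearIndependent_iff.1 (linearIndependent_toC hb) c h0))
  · refine h _ h0 ?_
    rw [complexify_span_range, Submodule.mem_span_range_iff_exists_fun]
    exact ⟨c, rfl⟩

theorem span_range_update (b : Fin ℓ → RVec d) (j : Fin ℓ) (v : RVec d) :
    Submodule.span ℝ (Set.range (Function.update b j v)) =
      Submodule.span ℝ (b '' {j}ᶜ) ⊔ Submodule.span ℝ {v} := by
  rw [← Submodule.span_union]
  congr 1
  ext x
  simp only [Set.mem_range, Set.union_singleton, Set.mem_insert_iff, Set.mem_image,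
    Set.mem_compl_iff, Set.mem_singleton_iff]
  constructor
  · rintro ⟨i, rfl⟩
    by_cases hi : i = j
    · subst hi; simp
    · exact Or.inr ⟨i, hi, by rw [Function.update_of_ne hi]⟩
  · rintro (rfl | ⟨i, hi, rfl⟩)
    · exact ⟨j, by simp⟩
    · exact ⟨i, by rw [Function.update_of_ne hi]⟩

theorem ImHyperbolic.update (hX : IsAlgebraic X) (hdim : IsPureDim X k) (hd : k + ℓ = d)
    {b : Fin ℓ → RVec d} {j : Fin ℓ} {v : RVec d}
    (h : ∀ s, Avoids X (Function.update b j (segmentPoint (b j) v s)))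
    (hb : ImHyperbolic X (Submodule.span ℝ (Set.range b))) :
    ImHyperbolic X (Submodule.span ℝ (Set.range (Function.update b j v))) := by
  have h0 : Function.update b j (segmentPoint (b j) v 0) = b := by simp [segmentPoint]
  have hli : LinearIndependent ℝ b := by
    have := (h 0).linearIndependent
    rwa [h0] at this
  rw [span_range_update]
  refine ImHyperbolic.of_segment (w := b j) hX hdim ?_ (fun s hs => ?_) (fun s z hz => ?_) ?_
  · have hli' : LinearIndependent ℝ fun i : ({j}ᶜ : Set (Fin ℓ)) => b i :=
      hli.comp _ Subtype.val_injective
    have h1 := finrank_span_eq_card hli'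
    have h2 : Set.range (fun i : ({j}ᶜ : Set (Fin ℓ)) => b i) = b '' {j}ᶜ := by
      rw [Set.image_eq_range]
    have h3 : Fintype.card ({j}ᶜ : Set (Fin ℓ)) = ℓ - 1 := by
      rw [Fintype.card_compl_set]; simp
    have := j.pos
    rw [← h2, h1, h3]
    omega
  · have h1 := (h s).linearIndependent.notMem_span_image (s := {j}ᶜ) (x := j) (by simp)
    rw [Function.update_self] at h1
    refine h1 ?_
    convert hs using 2
    refine Set.image_congr fun i hi => Function.update_of_ne hi _ _
  · rw [← span_range_update]
    exact (h s).notMem_complexify hz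
  · rwa [← span_range_update, Function.update_eq_self]

/-- In the sup metric the ball is a product of convex balls, so the entries of `b` can be replaced
one by one along segments without leaving it. -/
theorem ImHyperbolic.of_mem_ball (hX : IsAlgebraic X) (hdim : IsPureDim X k) (hd : k + ℓ = d)
    {e b b' : Fin ℓ → RVec d} {ε : ℝ} (hε : Metric.ball e ε ⊆ {b | Avoids X b})
    (hb : b ∈ Metric.ball e ε) (hb' : b' ∈ Metric.ball e ε)
    (h : ImHyperbolic X (Submodule.span ℝ (Set.range b))) :
    ImHyperbolic X (Submodule.span ℝ (Set.range b')) := by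
  classical
  have hpos : 0 < ε := Metric.pos_of_mem_ball hb
  have hmem (c : Fin ℓ → RVec d) : c ∈ Metric.ball e ε ↔ ∀ i, c i ∈ Metric.ball (e i) ε := by
    rw [Metric.mem_ball, dist_pi_lt_iff hpos]
    rfl
  rw [hmem] at hb hb'
  have key (S : Finset (Fin ℓ)) :
      ImHyperbolic X (Submodule.span ℝ (Set.range (S.piecewise b' b))) := by
    induction S using Finset.induction_on with
    | empty => rwa [Finset.piecewise_empty]
    | insert j S hj ih =>
      rw [Finset.piecewise_insert]
      refine ImHyperbolic.update hX hdim hd (fun s => hε ((hmem _).2 fun i => ?_)) ih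
      by_cases hi : i = j
      · subst hi
        rw [Function.update_self, Finset.piecewise_eq_of_notMem _ _ _ hj]
        exact (convex_ball (e i) ε) (hb i) (hb' i) (sub_nonneg.2 s.2.2) s.2.1 (by ring)
      · rw [Function.update_of_ne hi]
        by_cases hiS : i ∈ S
        · rw [Finset.piecewise_eq_of_mem _ _ _ hiS]
          exact hb' i
        · rw [Finset.piecewise_eq_of_notMem _ _ _ hiS]
          exact hb i
  have := key Finset.univ
  rwa [Finset.piecewise_univ] at this

/-- Away from the associated set, hyperbolicity is locally constant. -/
theorem eventually_imHyperbolic_iff (hX : IsAlgebraic X) (hdim : IsPureDim X k) (hd : k + ℓ = d)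
    {V₀ : RGrass ℓ d} (hV₀ : ∀ z ∈ coneOver X, z ∉ complexify V₀.1) :
    ∀ᶠ V : RGrass ℓ d in 𝓝 V₀, ImHyperbolic X V.1 ↔ ImHyperbolic X V₀.1 := by
  let B := Module.finBasisOfFinrankEq ℝ V₀.1 V₀.2
  let e : Fin ℓ → RVec d := fun i => (B i : RVec d)
  have heli : LinearIndependent ℝ e := B.linearIndependent.map' V₀.1.subtype V₀.1.ker_subtype
  have hspan (V : RGrass ℓ d) (b : Fin ℓ → RVec d) (hb : LinearIndependent ℝ b)
      (hbV : ∀ i, b i ∈ V.1) : Submodule.span ℝ (Set.range b) = V.1 := by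
    refine Submodule.eq_of_le_of_finrank_eq (Submodule.span_le.2 ?_) ?_
    · rintro _ ⟨i, rfl⟩
      exact hbV i
    · rw [finrank_span_eq_card hb, Fintype.card_fin, V.2]
  have hespan := hspan V₀ e heli fun i => (B i).2
  have heX : Avoids X e := avoids_of_linearIndependent heli (by rwa [hespan])
  obtain ⟨ε, hε, hball⟩ := Metric.isOpen_iff.1 (isOpen_avoids hX) e heX
  -- Projecting the basis `e` of `V₀` orthogonally gives vectors of `V` depending continuously on
  -- `V`; once in the ball they are independent, hence a basis of `V`.
  have hproj : Continuous fun V : RGrass ℓ d => fun i => V.1.starProjection (e i) := by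
    refine continuous_pi fun i => ?_
    have hc : Continuous fun V : RGrass ℓ d => (V.1.starProjection : RVec d →L[ℝ] RVec d) :=
      continuous_induced_dom
    exact hc.clm_apply continuous_const
  have hV₀e : (fun i => V₀.1.starProjection (e i)) = e :=
    funext fun i => Submodule.starProjection_eq_self_iff.2 (B i).2
  have hnear : ∀ᶠ V : RGrass ℓ d in 𝓝 V₀, (fun i => V.1.starProjection (e i)) ∈ Metric.ball e ε :=
    hproj.continuousAt.eventually (Metric.isOpen_ball.mem_nhds 
      (show (fun i => V₀.1.starProjection (e i)) ∈ Metric.ball e ε from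
        hV₀e.symm ▸ Metric.mem_ball_self hε))
  filter_upwards [hnear] with V hV
  have hVspan := hspan V _ (hball hV).linearIndependent
    fun i => Submodule.starProjection_apply_mem V.1 (e i)
  rw [← hVspan, ← hespan]
  exact ⟨ImHyperbolic.of_mem_ball hX hdim hd hball hV (Metric.mem_ball_self hε),
    ImHyperbolic.of_mem_ball hX hdim hd hball (Metric.mem_ball_self hε) hV⟩

theorem mem_compl_associatedReal_iff {V : RGrass ℓ d} :
    V ∈ (associatedReal X ℓ)ᶜ ↔ ∀ z ∈ coneOver X, z ∉ complexify V.1 := by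
  rw [← points_inter_eq_empty_iff, ← Set.not_nonempty_iff_eq_empty]
  rfl

end

end HypVar

end

theorem mainTheorem4 (d k ℓ : ℕ) (hℓ : 1 ≤ ℓ) (hd : k + ℓ = d)
    (X : Set (HypVar.CProj d)) (hX : HypVar.IsRealSubvariety X) (hdim : HypVar.IsPureDim X k)
    (V : HypVar.RGrass ℓ d) (hV : HypVar.IsHyperbolic X V) :
    ∀ V' ∈ connectedComponentIn (HypVar.associatedReal X ℓ)ᶜ V, HypVar.IsHyperbolic X V' := by
  have hloc (W : HypVar.RGrass ℓ d) (hW : W ∈ (HypVar.associatedReal X ℓ)ᶜ) :=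
    HypVar.eventually_imHyperbolic_iff hX.isAlgebraic hdim hd
      (HypVar.mem_compl_associatedReal_iff.1 hW)
  rw [HypVar.isHyperbolic_iff] at hV
  have hVmem : V ∈ (HypVar.associatedReal X ℓ)ᶜ :=
    HypVar.mem_compl_associatedReal_iff.2 fun z hz => hV.notMem_complexify hz
  let H : Set (HypVar.RGrass ℓ d) := {W | HypVar.ImHyperbolic X W.1}
  -- By local constancy, the disjoint interiors of `H` and of its complement cover the component,
  -- and `V` lies in the first.
  have hsub : connectedComponentIn (HypVar.associatedReal X ℓ)ᶜ V ⊆ interior H := by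
    refine isPreconnected_connectedComponentIn.subset_left_of_subset_union isOpen_interior
      (isOpen_interior (s := Hᶜ)) ?_ (fun W hW => ?_) ⟨V, mem_connectedComponentIn hVmem, ?_⟩
    · exact disjoint_compl_right.mono interior_subset interior_subset
    · have hW' := hloc W (connectedComponentIn_subset _ _ hW)
      by_cases h : HypVar.ImHyperbolic X W.1
      · exact Or.inl (mem_interior_iff_mem_nhds.2 (hW'.mono fun U hU => hU.2 h))
      · exact Or.inr (mem_interior_iff_mem_nhds.2 (hW'.mono fun U hU hUH => h (hU.1 hUH)))
    · exact mem_interior_iff_mem_nhds.2 ((hloc V hVmem).mono fun U hU => hU.2 hV)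
  exact fun V' hV' => HypVar.isHyperbolic_iff.2 (interior_subset (hsub hV'))
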